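/- Let $F$ be a global field, i.e. a number field or a finite extension of $\mathbb{F}_p(t)$ for some prime $p$, and let $\mathbb{A}_F$ be its ring of adèles. Let $\mathbb{H}$ be a (split or non-split) quaternion algebra over $F$, let $x\mapsto\bar x$ be its canonical involution, and let $\mathbb{A}_{\mathbb{H}}=\mathbb{H}\otimes_F\mathbb{A}_F$ with the induced involution $x\otimes a\mapsto \bar x\otimes a$, denoted $*$. Let $n\ge 1$ and let $A={\rm M}(n,\mathbb{A}_{\mathbb{H}})$ with the $*$-transpose involution $(a_{ij})^*=(a_{ji}^*)$; equip ${\rm M}(2,A)$ with the $*$-transpose involution as well. Put $J=\begin{pmatrix}0&1\\-1&0\end{pmatrix}$. Let ${\rm GL}_*(2,A)$ be the group of invertible $g\in{\rm M}(2,A)$ with $g^*Jg=\delta(g)J$ for some central, invertible, symmetric $\delta(g)\in A$, and let ${\rm SL}_*(2,A)$ be the subgroup of those $g=\begin{pmatrix}a&b\\c&d\end{pmatrix}\in{\rm GL}_*(2,A)$ with $\det_*(g)=ad^*-bc^*=1$. Its Bruhat elements are $$h_a=\begin{pmatrix}a^*&0\\0&a^{-1}\end{pmatrix}\ (a\in A^\times),\qquad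 u_b=\begin{pmatrix}1&b\\0&1\end{pmatrix}\ (b\in A,\ b^*=b),\qquad \omega=\begin{pmatrix}0&1\\-1&0\end{pmatrix}.$$ Then the group ${\rm SL}_*(2,A)$ is generated by its Bruhat elements if and only if ${\rm char}(F)=2$. -/

import Mathlib

open scoped TensorProduct

/-- A global field: a number field, or a finite extension of `𝔽_p(t)` for some prime `p`. -/
class IsGlobalField (F : Type*) [Field F] : Prop where
  numberField_or_functionField :
    NumberField F ∨ ∃ (p : ℕ) (_ : Fact p.Prime) (_ : Algebra (RatFunc (ZMod p)) F),
      FunctionField (ZMod p) F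

namespace GlobalField

section Independence

variable {K F : Type*} [Field K] [Field F] [Algebra K F]

theorem isNonarchimedean_comp {v : AbsoluteValue F ℝ} (hv : IsNonarchimedean v) :
    IsNonarchimedean (v.comp (algebraMap K F).injective) := fun x y => by
  have h := hv (algebraMap K F x) (algebraMap K F y)
  rw [← map_add] at h
  exact h

/-- Pairwise inequivalent nonarchimedean absolute values with equivalent restrictions to `K`
number at most `[F : K]`. -/
theorem card_le_finrank [FiniteDimensional K F] {m : ℕ} (v : Fin m → AbsoluteValue F ℝ)
    (hn : ∀ i, IsNonarchimedean (v i)) (ht : ∀ i, (v i).IsNontrivial)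
    (hp : Pairwise fun i j => ¬ (v i).IsEquiv (v j))
    (hr : ∀ i j, ((v i).comp (algebraMap K F).injective).IsEquiv
      ((v j).comp (algebraMap K F).injective)) :
    m ≤ Module.finrank K F := by
  choose a ha ha' using AbsoluteValue.exists_one_lt_lt_one_pi_of_not_isEquiv ht hp
  have hli : LinearIndependent K a := by
    rw [Fintype.linearIndependent_iff]
    intro c hc
    by_contra hne
    push Not at hne
    obtain ⟨i₀, hi₀⟩ := hne
    obtain ⟨k, -, hk⟩ := Finset.exists_max_image Finset.univ
      (fun i => v i₀ (algebraMap K F (c i))) ⟨i₀, Finset.mem_univ _⟩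
    have hk' : ∀ i, v k (algebraMap K F (c i)) ≤ v k (algebraMap K F (c k)) := fun i =>
      (hr i₀ k (c i) (c k)).1 (hk i (Finset.mem_univ _))
    have hck : 0 < v k (algebraMap K F (c k)) := by
      refine lt_of_lt_of_le ?_ (hk' i₀)
      simpa using hi₀
    have hlt := (hn k).apply_sum_eq_of_lt (f := v k) (s := Finset.univ)
      (l := fun i => c i • a i) (k := k) (by simp) (Finset.mem_univ k) (by
        intro j _ hj
        simp only [Algebra.smul_def, map_mul]
        calc v k (algebraMap K F (c j)) * v k (a j)
            ≤ v k (algebraMap K F (c k)) * v k (a j) :=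
              mul_le_mul_of_nonneg_right (hk' j) (AbsoluteValue.nonneg _ _)
          _ < v k (algebraMap K F (c k)) * v k (a k) :=
              mul_lt_mul_of_pos_left ((ha' j k hj.symm).trans (ha k)) hck)
    rw [hc] at hlt
    simp only [map_zero, Algebra.smul_def, map_mul] at hlt
    have : 0 < v k (a k) := zero_lt_one.trans (ha k)
    nlinarith
  simpa using hli.fintype_card_le_finrank

end Independence

section PID

variable {R K : Type*} [CommRing R] [IsDomain R] [IsPrincipalIdealRing R] [Field K] [Algebra R K]
  [IsFractionRing R K]

theorem isEquiv_of_prime {v w : AbsoluteValue K ℝ} (hv : IsNonarchimedean v)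
    (hw : IsNonarchimedean w) (hvR : ∀ r : R, v (algebraMap R K r) ≤ 1)
    (hwR : ∀ r : R, w (algebraMap R K r) ≤ 1) {π : R} (hπ : Prime π)
    (hvπ : v (algebraMap R K π) < 1) (hwπ : w (algebraMap R K π) < 1) : v.IsEquiv w := by
  have key : ∀ u : AbsoluteValue K ℝ, IsNonarchimedean u →
      (∀ r : R, u (algebraMap R K r) ≤ 1) → u (algebraMap R K π) < 1 →
      ∀ r : R, ¬ π ∣ r → u (algebraMap R K r) = 1 := by
    intro u hu huR huπ r hr
    obtain ⟨x, y, hxy⟩ := (hπ.irreducible.coprime_iff_not_dvd).2 hr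
    refine le_antisymm (huR r) ?_
    by_contra hlt
    push Not at hlt
    have h1 : u (algebraMap R K (x * π + y * r)) < 1 := by
      rw [map_add, map_mul, map_mul]
      refine (hu _ _).trans_lt (max_lt ?_ ?_)
      · rw [map_mul]
        exact (mul_le_of_le_one_left (u.nonneg _) (huR x)).trans_lt huπ
      · rw [map_mul]
        exact (mul_le_of_le_one_left (u.nonneg _) (huR y)).trans_lt hlt
    rw [hxy] at h1
    simp at h1
  have hπ0 : algebraMap R K π ≠ 0 := by
    simpa using hπ.ne_zero
  have fac : ∀ r : R, r ≠ 0 → ∃ n : ℕ, ∀ u : AbsoluteValue K ℝ, IsNonarchimedean u →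
      (∀ r : R, u (algebraMap R K r) ≤ 1) → u (algebraMap R K π) < 1 →
      u (algebraMap R K r) = u (algebraMap R K π) ^ n := by
    intro r hr
    obtain ⟨n, s, hs, rfl⟩ := WfDvdMonoid.max_power_factor hr hπ.irreducible
    exact ⟨n, fun u hu huR huπ => by simp [key u hu huR huπ s hs]⟩
  have hnt : v.IsNontrivial := ⟨_, hπ0, hvπ.ne⟩
  refine AbsoluteValue.isEquiv_of_lt_one_imp hnt fun x hx => ?_
  obtain ⟨r, s, hs, rfl⟩ := IsFractionRing.div_surjective (A := R) x
  have hs0 : s ≠ 0 := nonZeroDivisors.ne_zero hs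
  by_cases hr0 : r = 0
  · simp [hr0]
  obtain ⟨n, hn⟩ := fac r hr0
  obtain ⟨m, hm⟩ := fac s hs0
  rw [map_div₀, hn v hv hvR hvπ, hm v hv hvR hvπ] at hx
  rw [map_div₀, hn w hw hwR hwπ, hm w hw hwR hwπ]
  have hv0 := v.pos hπ0
  have hw0 := w.pos hπ0
  rw [div_lt_one (pow_pos hv0 _)] at hx
  rw [div_lt_one (pow_pos hw0 _)]
  have hmn : m < n := (pow_lt_pow_iff_right_of_lt_one₀ hv0 hvπ).1 hx
  exact (pow_lt_pow_iff_right_of_lt_one₀ hw0 hwπ).2 hmn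

/-- If `y ∈ K` has absolute value `> 1`, then some prime factor of a denominator has
absolute value `< 1`. -/
theorem exists_finset_prime (y : K) : ∃ T : Finset R, (∀ π ∈ T, Prime π) ∧
    ∀ v : AbsoluteValue K ℝ, (∀ r : R, v (algebraMap R K r) ≤ 1) → 1 < v y →
      ∃ π ∈ T, v (algebraMap R K π) < 1 := by
  classical
  obtain ⟨r, s, hs, rfl⟩ := IsFractionRing.div_surjective (A := R) y
  have hs0 : s ≠ 0 := nonZeroDivisors.ne_zero hs
  obtain ⟨f, hf, hfs⟩ := UniqueFactorizationMonoid.exists_prime_factors s hs0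
  refine ⟨f.toFinset, fun π hπ => hf π (by simpa using hπ), fun v hv hy => ?_⟩
  by_contra hcon
  push Not at hcon
  have h1 : ∀ π ∈ f, v (algebraMap R K π) = 1 := fun π hπ =>
    le_antisymm (hv π) (hcon π (by simpa using hπ))
  have hprod : v (algebraMap R K f.prod) = 1 := by
    rw [map_multiset_prod, map_multiset_prod]
    refine Multiset.prod_eq_one ?_
    intro x hx
    simp only [Multiset.mem_map] at hx
    obtain ⟨_, ⟨π, hπ, rfl⟩, rfl⟩ := hx
    exact h1 π hπ
  obtain ⟨u, hu⟩ := hfs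
  have hsu : v (algebraMap R K s) = 1 := by
    refine le_antisymm (hv s) ?_
    have h2 : f.prod = s * ↑u⁻¹ := by rw [← hu]; simp [mul_assoc]
    rw [h2, map_mul, map_mul] at hprod
    have := hv (↑u⁻¹ : R)
    have h3 := v.nonneg (algebraMap R K s)
    nlinarith [v.nonneg (algebraMap R K (↑u⁻¹ : R))]
  rw [map_div₀, hsu, div_one] at hy
  exact absurd (hv r) (not_le.2 hy)

end PID

/-- `K` satisfies: up to equivalence, only finitely many nonarchimedean absolute values are
`> 1` at a given element. -/
def FinitelyManyPoles (K : Type*) [Field K] : Prop :=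
  ∀ y : K, ∃ T : Finset (AbsoluteValue K ℝ), ∀ v : AbsoluteValue K ℝ, IsNonarchimedean v →
    1 < v y → ∃ w ∈ T, v.IsEquiv w

theorem exists_finset_of_pid (R : Type*) {K : Type*} [CommRing R] [IsDomain R]
    [IsPrincipalIdealRing R] [Field K] [Algebra R K] [IsFractionRing R K] (y : K) :
    ∃ T : Finset (AbsoluteValue K ℝ), ∀ v : AbsoluteValue K ℝ, IsNonarchimedean v →
      (∀ r : R, v (algebraMap R K r) ≤ 1) → 1 < v y → ∃ w ∈ T, v.IsEquiv w := by
  classical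
  obtain ⟨T, hT, h⟩ := exists_finset_prime (R := R) y
  let P : R → AbsoluteValue K ℝ → Prop := fun π w => IsNonarchimedean w ∧
    (∀ r : R, w (algebraMap R K r) ≤ 1) ∧ w (algebraMap R K π) < 1
  let g : R → AbsoluteValue K ℝ := fun π =>
    if hπ : ∃ w, P π w then hπ.choose else AbsoluteValue.trivial
  refine ⟨T.image g, fun v hv hvR hy => ?_⟩
  obtain ⟨π, hπT, hπ⟩ := h v hvR hy
  have hex : ∃ w, P π w := ⟨v, hv, hvR, hπ⟩
  refine ⟨g π, Finset.mem_image_of_mem _ hπT, ?_⟩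
  have hg : g π = hex.choose := dif_pos hex
  obtain ⟨h1, h2, h3⟩ := hex.choose_spec
  rw [hg]
  exact isEquiv_of_prime hv h1 hvR h2 (hT π hπT) hπ h3

theorem finitelyManyPoles_rat : FinitelyManyPoles ℚ := fun y => by
  obtain ⟨T, hT⟩ := exists_finset_of_pid ℤ y
  refine ⟨T, fun v hv hy => hT v hv (fun r => ?_) hy⟩
  have := hv.apply_intCast_le_one (n := r)
  simpa using this

section RatFunc

variable {p : ℕ} [Fact p.Prime]

theorem abv_const (v : AbsoluteValue (RatFunc (ZMod p)) ℝ) (c : ZMod p) (hc : c ≠ 0) :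
    v (algebraMap (ZMod p) (RatFunc (ZMod p)) c) = 1 := by
  have h := ZMod.pow_card_sub_one_eq_one hc
  have h2 : v (algebraMap (ZMod p) (RatFunc (ZMod p)) c) ^ (p - 1) = 1 := by
    rw [← map_pow, ← map_pow, h, map_one, map_one]
  exact (pow_eq_one_iff_of_nonneg (v.nonneg _)
    (Nat.sub_ne_zero_of_lt (Fact.out : p.Prime).one_lt)).1 h2

theorem abv_const_le (v : AbsoluteValue (RatFunc (ZMod p)) ℝ) (c : ZMod p) :
    v (algebraMap (ZMod p) (RatFunc (ZMod p)) c) ≤ 1 := by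
  by_cases hc : c = 0
  · simp [hc]
  · exact (abv_const v c hc).le

/-- A nonarchimedean absolute value as a valuation. -/
noncomputable def toValuation {K : Type*} [Field K] (v : AbsoluteValue K ℝ)
    (hv : IsNonarchimedean v) : Valuation K NNReal where
  toFun x := (v x).toNNReal
  map_zero' := by simp
  map_one' := by simp
  map_mul' x y := by rw [map_mul, Real.toNNReal_mul (v.nonneg x)]
  map_add_le_max' x y := by
    have h := Real.toNNReal_le_toNNReal (hv x y)
    rwa [Monotone.map_max (f := Real.toNNReal) fun _ _ h => Real.toNNReal_le_toNNReal h] at h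

theorem coe_toValuation {K : Type*} [Field K] (v : AbsoluteValue K ℝ)
    (hv : IsNonarchimedean v) (x : K) : (toValuation v hv x : ℝ) = v x :=
  Real.coe_toNNReal _ (v.nonneg x)

theorem isEquiv_of_one_lt_X {v w : AbsoluteValue (RatFunc (ZMod p)) ℝ} (hv : IsNonarchimedean v)
    (hw : IsNonarchimedean w) (hvX : 1 < v RatFunc.X) (hwX : 1 < w RatFunc.X) : v.IsEquiv w := by
  have key : ∀ u : AbsoluteValue (RatFunc (ZMod p)) ℝ, IsNonarchimedean u → 1 < u RatFunc.X →
      ∀ f : RatFunc (ZMod p), f ≠ 0 → u f = u RatFunc.X ^ f.intDegree := by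
    intro u hu huX f hf
    have : (toValuation u hu).IsTrivialOn (ZMod p) :=
      ⟨fun c hc => by ext; rw [coe_toValuation]; exact abv_const u c hc⟩
    have h := RatFunc.valuation_eq_valuation_X_zpow_intDegree_of_one_lt_valuation_X
      (v := toValuation u hu) (by rw [← NNReal.coe_lt_coe, coe_toValuation]; exact huX) hf
    have h' := congrArg NNReal.toReal h
    rwa [NNReal.coe_zpow, coe_toValuation, coe_toValuation] at h'
  have hnt : v.IsNontrivial := ⟨_, RatFunc.X_ne_zero, hvX.ne'⟩
  refine AbsoluteValue.isEquiv_of_lt_one_imp hnt fun f hf => ?_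
  by_cases hf0 : f = 0
  · simp [hf0]
  rw [key v hv hvX f hf0, zpow_lt_one_iff_right₀ hvX] at hf
  rwa [key w hw hwX f hf0, zpow_lt_one_iff_right₀ hwX]

theorem finitelyManyPoles_ratFunc : FinitelyManyPoles (RatFunc (ZMod p)) := fun y => by
  classical
  obtain ⟨T, hT⟩ := exists_finset_of_pid (Polynomial (ZMod p)) y
  by_cases hex : ∃ w : AbsoluteValue (RatFunc (ZMod p)) ℝ, IsNonarchimedean w ∧ 1 < w RatFunc.X
  · obtain ⟨w, hw, hwX⟩ := hex
    refine ⟨insert w T, fun v hv hy => ?_⟩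
    by_cases hX : 1 < v RatFunc.X
    · exact ⟨w, by simp, isEquiv_of_one_lt_X hv hw hX hwX⟩
    · obtain ⟨u, hu, huv⟩ := hT v hv (poly v hv (not_lt.1 hX)) hy
      exact ⟨u, by simp [hu], huv⟩
  · push Not at hex
    exact ⟨T, fun v hv hy => hT v hv (poly v hv (hex v hv)) hy⟩
where
  poly (v : AbsoluteValue (RatFunc (ZMod p)) ℝ) (hv : IsNonarchimedean v)
      (hX : v RatFunc.X ≤ 1) (r : Polynomial (ZMod p)) :
      v (algebraMap (Polynomial (ZMod p)) (RatFunc (ZMod p)) r) ≤ 1 := by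
    induction r using Polynomial.induction_on' with
    | add f g hf hg =>
      rw [map_add]
      exact (hv _ _).trans (max_le hf hg)
    | monomial n c =>
      rw [← Polynomial.C_mul_X_pow_eq_monomial, map_mul, map_mul, map_pow, map_pow,
        RatFunc.algebraMap_X, RatFunc.algebraMap_C]
      have h1 : v (RatFunc.C c) ≤ 1 := by
        rw [← RatFunc.algebraMap_eq_C]
        exact abv_const_le v c
      exact mul_le_one₀ h1 (pow_nonneg (v.nonneg _) _) (pow_le_one₀ (v.nonneg _) hX)

end RatFunc


end GlobalField

/-- Places of `F`: equivalence classes of nontrivial real absolute values. -/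
def Place (F : Type*) [Field F] : Type _ :=
  Quotient (Setoid.comap (Subtype.val : {v : AbsoluteValue F ℝ // v.IsNontrivial} →
    AbsoluteValue F ℝ) inferInstance)

namespace Place

variable {F : Type*} [Field F]

/-- A chosen absolute value in the class `v`. -/
noncomputable def abv (v : Place F) : AbsoluteValue F ℝ := (Quotient.out v).1

theorem isNontrivial_abv (v : Place F) : v.abv.IsNontrivial := (Quotient.out v).2

theorem eq_of_isEquiv {v w : Place F} (h : v.abv.IsEquiv w.abv) : v = w :=
  Quotient.out_equiv_out.1 h

/-- The place `v` is nonarchimedean (finite). -/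
def IsFinite (v : Place F) : Prop := IsNonarchimedean v.abv

/-- The completion `F_v`. -/
abbrev Completion (v : Place F) : Type _ := v.abv.Completion

theorem norm_algebraMap (v : Place F) (x : F) : ‖algebraMap F v.Completion x‖ = v.abv x :=
  UniformSpace.Completion.norm_coe (WithAbs.toAbs v.abv x)

theorem norm_add_le_max {v : Place F} (hv : v.IsFinite) (x y : v.Completion) :
    ‖x + y‖ ≤ max ‖x‖ ‖y‖ := by
  induction x, y using UniformSpace.Completion.induction_on₂ with
  | hp => exact isClosed_le (by fun_prop) (by fun_prop)
  | ih a b =>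
    rw [← UniformSpace.Completion.coe_add]
    simp only [UniformSpace.Completion.norm_coe]
    exact hv a.ofAbs b.ofAbs

section Finiteness

variable {K : Type*} [Field K] [Algebra K F] [FiniteDimensional K F]

theorem finite_above (w : AbsoluteValue K ℝ) :
    {v : Place F | v.IsFinite ∧ (v.abv.comp (algebraMap K F).injective).IsEquiv w}.Finite := by
  by_contra hinf
  obtain ⟨t, hts, htc⟩ := Set.Infinite.exists_subset_card_eq hinf (Module.finrank K F + 1)
  let e := (Fintype.equivFinOfCardEq (α := t) (by simpa using htc)).symm
  have hmem : ∀ i, (e i : Place F).IsFinite ∧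
      ((e i : Place F).abv.comp (algebraMap K F).injective).IsEquiv w := fun i => hts (e i).2
  have := GlobalField.card_le_finrank (K := K) (fun i => (e i : Place F).abv)
    (fun i => (hmem i).1) (fun i => isNontrivial_abv _)
    (fun i j hij h => hij (e.injective (Subtype.ext (eq_of_isEquiv h))))
    (fun i j => (hmem i).2.trans (hmem j).2.symm)
  omega

theorem exists_coeff {v : AbsoluteValue F ℝ} (hv : IsNonarchimedean v) {x : F} (hx : 1 < v x) :
    ∃ i ∈ Finset.range (minpoly K x).natDegree,
      1 < v (algebraMap K F ((minpoly K x).coeff i)) := by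
  by_contra hcon
  push Not at hcon
  have hm := minpoly.monic (Algebra.IsIntegral.isIntegral (R := K) x)
  have h0 := minpoly.aeval K x
  rw [Polynomial.aeval_eq_sum_range, Finset.sum_range_succ, hm.coeff_natDegree, one_smul] at h0
  have hd : 0 < (minpoly K x).natDegree :=
    minpoly.natDegree_pos (Algebra.IsIntegral.isIntegral (R := K) x)
  set d := (minpoly K x).natDegree with hdd
  have h1 : x ^ d = -∑ i ∈ Finset.range d, (minpoly K x).coeff i • x ^ i := by
    rw [eq_neg_iff_add_eq_zero, add_comm]; exact h0
  obtain ⟨i, hi, hle⟩ := hv.finset_image_add (by simp) (fun a => v.nonneg a)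
    (fun i => (minpoly K x).coeff i • x ^ i) (Finset.range d)
  have hid : i < d := by simpa using hi ⟨0, by simpa using hd⟩
  have h2 : v (x ^ d) ≤ v x ^ i := by
    rw [h1, AbsoluteValue.map_neg]
    refine hle.trans ?_
    rw [Algebra.smul_def, map_mul, map_pow]
    exact mul_le_of_le_one_left (pow_nonneg (v.nonneg _) _) (hcon i (by simpa using hid))
  rw [map_pow] at h2
  exact absurd h2 (not_le.2 (pow_lt_pow_right₀ hx hid))

theorem finite_poles_of (hK : GlobalField.FinitelyManyPoles K) (x : F) :
    {v : Place F | v.IsFinite ∧ 1 < v.abv x}.Finite := by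
  choose T hT using hK
  refine Set.Finite.subset (Set.Finite.biUnion
    (Finset.range (minpoly K x).natDegree).finite_toSet
    (fun i _ => Set.Finite.biUnion (T ((minpoly K x).coeff i)).finite_toSet
      (fun w _ => finite_above (F := F) w))) ?_
  rintro v ⟨hv, hx⟩
  obtain ⟨i, hi, hic⟩ := exists_coeff (K := K) hv hx
  obtain ⟨w, hw, hvw⟩ := hT _ (v.abv.comp (algebraMap K F).injective)
    (GlobalField.isNonarchimedean_comp hv) hic
  simp only [Set.mem_iUnion]
  exact ⟨i, hi, w, hw, hv, hvw⟩

end Finiteness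

theorem finite_poles [IsGlobalField F] (x : F) :
    {v : Place F | v.IsFinite ∧ 1 < v.abv x}.Finite := by
  rcases IsGlobalField.numberField_or_functionField (F := F) with h | ⟨p, _, _, _⟩
  · exact finite_poles_of GlobalField.finitelyManyPoles_rat x
  · exact finite_poles_of (K := RatFunc (ZMod p)) GlobalField.finitelyManyPoles_ratFunc x

end Place

/-- The adele ring `𝔸_F`: families `(x_v)` in `∏ F_v`, over all places `v` of `F`, with `x_v` in
the ring of integers `{‖x_v‖ ≤ 1}` of `F_v` for all but finitely many nonarchimedean `v`. -/
def adeles (F : Type*) [Field F] [IsGlobalField F] :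
    Subalgebra F (∀ v : Place F, v.Completion) where
  carrier := {x | {v : Place F | v.IsFinite ∧ 1 < ‖x v‖}.Finite}
  mul_mem' {x y} hx hy := (hx.union hy).subset fun v ⟨hv, h⟩ => by
    by_contra hcon
    simp only [Set.mem_union, Set.mem_ofPred_eq, hv, true_and, not_or, not_lt] at hcon
    rw [Pi.mul_apply, norm_mul] at h
    exact absurd h (not_lt.2 (mul_le_one₀ hcon.1 (norm_nonneg _) hcon.2))
  add_mem' {x y} hx hy := (hx.union hy).subset fun v ⟨hv, h⟩ => by
    by_contra hcon
    simp only [Set.mem_union, Set.mem_ofPred_eq, hv, true_and, not_or, not_lt] at hcon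
    exact absurd h (not_lt.2 ((Place.norm_add_le_max hv _ _).trans (max_le hcon.1 hcon.2)))
  algebraMap_mem' x := by
    refine (Place.finite_poles x).subset fun v ⟨hv, h⟩ => ⟨hv, ?_⟩
    rwa [Pi.algebraMap_apply, Place.norm_algebraMap] at h

/-- The adele ring `𝔸_F` as an `F`-algebra, with `F` diagonally embedded. -/
abbrev AdeleRing (F : Type*) [Field F] [IsGlobalField F] : Type _ := adeles F

/-- `H` is a quaternion algebra over `F` (of any characteristic): `H` has an `F`-basis `1, i, j, ij`
with `i² = a + b i`, `j² = c`, `j i = (b - i) j`, where `X² - bX - a` is separable and `c ≠ 0`. -/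
class IsQuaternionAlgebra (F H : Type*) [Field F] [Ring H] [Algebra F H] : Prop where
  exists_algEquiv : ∃ a b c : F, b ^ 2 + 4 * a ≠ 0 ∧ c ≠ 0 ∧
    Nonempty (H ≃ₐ[F] QuaternionAlgebra F a b c)

namespace QuaternionConj

variable {F H : Type*} [Field F] [Ring H] [Algebra F H]

/-- `σ` is the canonical involution: it is `F`-linear, fixes `1`, and `x + σ x` (the reduced trace)
and `x σ(x)` (the reduced norm) lie in `F`. -/
def IsCanonicalInvolution (σ : H →ₗ[F] H) : Prop :=
  σ 1 = 1 ∧ ∀ x, ∃ t n : F, x + σ x = algebraMap F H t ∧ x * σ x = algebraMap F H n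

theorem IsCanonicalInvolution.eq {σ τ : H →ₗ[F] H} (hσ : IsCanonicalInvolution σ)
    (hτ : IsCanonicalInvolution τ) : σ = τ := by
  ext x
  by_cases hx : ∃ r, algebraMap F H r = x
  · obtain ⟨r, rfl⟩ := hx
    rw [Algebra.algebraMap_eq_smul_one, map_smul, map_smul, hσ.1, hτ.1]
  obtain ⟨t, n, ht, hn⟩ := hσ.2 x
  obtain ⟨t', n', ht', hn'⟩ := hτ.2 x
  have h1 : σ x = algebraMap F H t - x := by rw [← ht]; abel
  have h2 : τ x = algebraMap F H t' - x := by rw [← ht']; abel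
  rw [h1, mul_sub] at hn
  rw [h2, mul_sub] at hn'
  have h3 : x * algebraMap F H (t - t') = algebraMap F H (n - n') := by
    rw [map_sub, map_sub, mul_sub, ← hn, ← hn']; abel
  by_cases htt : t = t'
  · rw [h1, h2, htt]
  · refine absurd ⟨(n - n') * (t - t')⁻¹, ?_⟩ hx
    rw [map_mul, ← h3, mul_assoc, ← map_mul, mul_inv_cancel₀ (sub_ne_zero.2 htt), map_one, mul_one]

/-- The conjugation of `QuaternionAlgebra F a b c`, transported to `H`. -/
def transportStar {a b c : F} (e : H ≃ₐ[F] QuaternionAlgebra F a b c) : H →ₗ[F] H where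
  toFun x := e.symm (star (e x))
  map_add' x y := by simp
  map_smul' r x := by simp

theorem isCanonicalInvolution_transportStar {a b c : F} (e : H ≃ₐ[F] QuaternionAlgebra F a b c) :
    IsCanonicalInvolution (transportStar e) := by
  refine ⟨by simp [transportStar], fun x => ⟨2 * (e x).re + b * (e x).imI,
    (e x * star (e x)).re, e.injective ?_, e.injective ?_⟩⟩
  · rw [map_add, AlgEquiv.commutes]
    simp only [transportStar, LinearMap.coe_mk, AddHom.coe_mk, AlgEquiv.apply_symm_apply]
    exact QuaternionAlgebra.self_add_star' (e x)
  · simp only [transportStar, LinearMap.coe_mk, AddHom.coe_mk, map_mul, AlgEquiv.apply_symm_apply,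
      AlgEquiv.commutes]
    exact QuaternionAlgebra.mul_star_eq_coe (e x)

variable (F H) in
theorem exists_isCanonicalInvolution [h : IsQuaternionAlgebra F H] :
    ∃ σ : H →ₗ[F] H, IsCanonicalInvolution σ := by
  obtain ⟨a, b, c, _, _, ⟨e⟩⟩ := h.exists_algEquiv
  exact ⟨_, isCanonicalInvolution_transportStar e⟩

variable (F H) in
/-- The canonical involution (conjugation) of a quaternion algebra. -/
noncomputable def conj [IsQuaternionAlgebra F H] : H →ₗ[F] H :=
  (exists_isCanonicalInvolution F H).choose

theorem isCanonicalInvolution_conj [IsQuaternionAlgebra F H] :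
    IsCanonicalInvolution (conj F H) :=
  (exists_isCanonicalInvolution F H).choose_spec

theorem algEquiv_conj [IsQuaternionAlgebra F H] {a b c : F}
    (e : H ≃ₐ[F] QuaternionAlgebra F a b c) (x : H) : e (conj F H x) = star (e x) := by
  rw [isCanonicalInvolution_conj.eq (isCanonicalInvolution_transportStar e)]
  simp [transportStar]

theorem conj_conj [h : IsQuaternionAlgebra F H] (x : H) : conj F H (conj F H x) = x := by
  obtain ⟨a, b, c, _, _, ⟨e⟩⟩ := h.exists_algEquiv
  exact e.injective (by simp [algEquiv_conj e])

theorem conj_mul [h : IsQuaternionAlgebra F H] (x y : H) :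
    conj F H (x * y) = conj F H y * conj F H x := by
  obtain ⟨a, b, c, _, _, ⟨e⟩⟩ := h.exists_algEquiv
  exact e.injective (by simp [algEquiv_conj e])

variable (F H) in
/-- The involution `x ⊗ a ↦ x̄ ⊗ a` of `H ⊗ B`. -/
noncomputable def extend [IsQuaternionAlgebra F H] (B : Type*) [CommRing B] [Algebra F B] :
    H ⊗[F] B →ₗ[F] H ⊗[F] B :=
  TensorProduct.map (conj F H) LinearMap.id

theorem extend_extend [IsQuaternionAlgebra F H] {B : Type*} [CommRing B] [Algebra F B]
    (x : H ⊗[F] B) : extend F H B (extend F H B x) = x := by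
  induction x using TensorProduct.induction_on with
  | zero => simp
  | tmul h a => simp [extend, conj_conj]
  | add x y hx hy => rw [map_add, map_add, hx, hy]

theorem extend_mul [IsQuaternionAlgebra F H] {B : Type*} [CommRing B] [Algebra F B]
    (x y : H ⊗[F] B) : extend F H B (x * y) = extend F H B y * extend F H B x := by
  induction x using TensorProduct.induction_on with
  | zero => simp
  | tmul h a =>
    induction y using TensorProduct.induction_on with
    | zero => simp
    | tmul h' a' => simp [extend, conj_mul, mul_comm]
    | add y z hy hz => rw [mul_add, map_add, hy, hz, map_add, add_mul]
  | add x z hx hz => rw [add_mul, map_add, hx, hz, map_add, mul_add]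

end QuaternionConj

/-- The ring of adelic quaternions `𝔸_H = H ⊗_F 𝔸_F`. -/
def AdelicQuaternions (F H : Type*) [Field F] [IsGlobalField F] [Ring H] [Algebra F H] : Type _ :=
  H ⊗[F] AdeleRing F

namespace AdelicQuaternions

variable (F H : Type*) [Field F] [IsGlobalField F] [Ring H] [Algebra F H]

noncomputable instance : Ring (AdelicQuaternions F H) :=
  inferInstanceAs (Ring (H ⊗[F] AdeleRing F))

/-- The involution of `𝔸_H` induced by the canonical involution of `H`. -/
noncomputable instance [IsQuaternionAlgebra F H] : StarRing (AdelicQuaternions F H) where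
  star x := QuaternionConj.extend F H (AdeleRing F) x
  star_involutive x := QuaternionConj.extend_extend (F := F) (H := H) (B := AdeleRing F) x
  star_add x y := map_add (QuaternionConj.extend F H (AdeleRing F)) x y
  star_mul x y := QuaternionConj.extend_mul (F := F) (H := H) (B := AdeleRing F) x y

end AdelicQuaternions

section SLStar

variable (A : Type*) [Ring A] [StarRing A]

/-- `GL_*(2, A)`: invertible `g` with `g^* J g = δ J`, where `J = (0 1; -1 0)` and `δ` is a central
invertible symmetric element of `A`. Here `star` on `2 × 2` matrices is the `*`-transpose. -/
def GLStar : Set (Matrix (Fin 2) (Fin 2) A)ˣ :=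
  {g | ∃ δ : A, δ ∈ Set.center A ∧ IsUnit δ ∧ star δ = δ ∧
    star g.val * !![0, 1; -1, 0] * g.val = δ • !![0, 1; -1, 0]}

variable {A} in
/-- `det_* (a b; c d) = a d^* - b c^*`. -/
def detStar (g : Matrix (Fin 2) (Fin 2) A) : A := g 0 0 * star (g 1 1) - g 0 1 * star (g 1 0)

theorem mem_GLStar_and_detStar_iff (g : (Matrix (Fin 2) (Fin 2) A)ˣ) :
    (g ∈ GLStar A ∧ detStar g.val = 1) ↔
      star g.val * !![0, 1; -1, 0] * g.val = !![0, 1; -1, 0] := by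
  obtain ⟨J, hJdef⟩ : ∃ J : Matrix (Fin 2) (Fin 2) A, J = !![0, 1; -1, 0] := ⟨_, rfl⟩
  have hJ : J * J = -1 := by
    ext i j; fin_cases i <;> fin_cases j <;> simp [hJdef]
  have key : ∀ δ : A, δ ∈ Set.center A → star g.val * J * g.val = δ • J →
      detStar g.val = δ := by
    intro δ hc h
    have hcomm : ∀ X Y : Matrix (Fin 2) (Fin 2) A, X * (δ • Y) = δ • (X * Y) := by
      intro X Y
      ext i j
      simp only [Matrix.mul_apply, Matrix.smul_apply, smul_eq_mul, Finset.mul_sum]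
      refine Finset.sum_congr rfl fun k _ => ?_
      rw [← mul_assoc, ← mul_assoc, ((Set.mem_center_iff.1 hc).comm (X i k)).eq]
    have h1 : star g.val * J = δ • (J * (g⁻¹).val) := by
      rw [← smul_mul_assoc, ← h, mul_assoc, Units.mul_inv, mul_one]
    have h2 : g.val * J * (star g.val * J) = δ • (-1) := by
      rw [h1, hcomm, ← mul_assoc, mul_assoc g.val J J, hJ]
      simp
    have h3 : g.val * J * star g.val = δ • J := by
      have h4 : g.val * J * (star g.val * J) * J = -(g.val * J * star g.val) := by
        rw [mul_assoc (g.val * J), mul_assoc (star g.val), hJ]; simp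
      rw [h2] at h4
      rw [← neg_eq_iff_eq_neg.2 h4]
      simp
    have h5 := congrFun (congrFun h3 0) 1
    simp [hJdef, Matrix.mul_apply, Fin.sum_univ_two, Matrix.star_apply] at h5
    rw [detStar, ← h5]
    abel
  rw [← hJdef]
  constructor
  · rintro ⟨⟨δ, hc, _, _, h⟩, hdet⟩
    rw [← hJdef] at h
    rw [h, ← key δ hc h, hdet, one_smul]
  · intro h
    refine ⟨⟨1, Set.one_mem_center, isUnit_one, star_one A, by rw [← hJdef, h, one_smul]⟩, ?_⟩
    exact key 1 Set.one_mem_center (by rw [h, one_smul])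

/-- `SL_*(2, A)`, the kernel of `det_*` on `GL_*(2, A)`. -/
def SLStar : Subgroup (Matrix (Fin 2) (Fin 2) A)ˣ where
  carrier := {g | g ∈ GLStar A ∧ detStar g.val = 1}
  mul_mem' {g h} hg hh := by
    rw [Set.mem_ofPred_eq, mem_GLStar_and_detStar_iff] at *
    rw [Units.val_mul, star_mul]
    calc _ = star h.val * (star g.val * !![0, 1; -1, 0] * g.val) * h.val := by
            simp only [mul_assoc]
      _ = _ := by rw [hg, hh]
  one_mem' := by
    rw [Set.mem_ofPred_eq, mem_GLStar_and_detStar_iff]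
    simp
  inv_mem' {g} hg := by
    rw [Set.mem_ofPred_eq, mem_GLStar_and_detStar_iff] at *
    have h1 : star (g⁻¹).val * star g.val = 1 := by rw [← star_mul, Units.mul_inv, star_one]
    calc _ = star (g⁻¹).val * (star g.val * !![0, 1; -1, 0] * g.val) * (g⁻¹).val := by rw [hg]
      _ = (star (g⁻¹).val * star g.val) * !![0, 1; -1, 0] * (g.val * (g⁻¹).val) := by
            simp only [mul_assoc]
      _ = _ := by rw [h1, Units.mul_inv, one_mul, mul_one]

theorem mem_SLStar_iff (g : (Matrix (Fin 2) (Fin 2) A)ˣ) :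
    g ∈ SLStar A ↔ star g.val * !![0, 1; -1, 0] * g.val = !![0, 1; -1, 0] :=
  mem_GLStar_and_detStar_iff A g

/-- The Bruhat element `h_a`. -/
def bruhatH (a : Aˣ) : SLStar A :=
  ⟨⟨!![star a.val, 0; 0, (a⁻¹).val], !![star (a⁻¹).val, 0; 0, a.val],
    by simp [Matrix.one_fin_two, ← star_mul], by simp [Matrix.one_fin_two, ← star_mul]⟩, by
    rw [mem_SLStar_iff]
    ext i j; fin_cases i <;> fin_cases j <;>
      simp [Matrix.mul_apply, Fin.sum_univ_two, Matrix.star_apply, ← star_mul]⟩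

/-- The Bruhat element `u_b`, for symmetric `b`. -/
def bruhatU (b : A) (hb : star b = b) : SLStar A :=
  ⟨⟨!![1, b; 0, 1], !![1, -b; 0, 1],
    by simp [Matrix.one_fin_two], by simp [Matrix.one_fin_two]⟩, by
    rw [mem_SLStar_iff]
    ext i j; fin_cases i <;> fin_cases j <;>
      simp [Matrix.mul_apply, Fin.sum_univ_two, Matrix.star_apply, hb]⟩

/-- The Bruhat element `ω`. -/
def bruhatW : SLStar A :=
  ⟨⟨!![0, 1; -1, 0], !![0, -1; 1, 0],
    by simp [Matrix.one_fin_two], by simp [Matrix.one_fin_two]⟩, by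
    rw [mem_SLStar_iff]
    ext i j; fin_cases i <;> fin_cases j <;>
      simp [Matrix.mul_apply, Fin.sum_univ_two, Matrix.star_apply]⟩

/-- The set of Bruhat elements of `SL_*(2, A)`. -/
def bruhatElements : Set (SLStar A) :=
  Set.range (bruhatH A) ∪ {g | ∃ (b : A) (hb : star b = b), g = bruhatU A b hb} ∪ {bruhatW A}

end SLStar

/-!
Write `A = M(n, 𝔸_H)`. The group `SL_*(2, A)` is the isometry group of the hyperbolic
skew-hermitian form of rank `2 n` over the adelic quaternions. It behaves like a full orthogonal
group if `2 ≠ 0`, and like a symplectic group in characteristic two.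

**Characteristic different from two.** Let `H` have structure constants `a, b, c` and put
`D = b² + 4a`. At some place `v` the element `D` is a square (`Place.exists_sq_eq`), so that `H`
splits over `F_v` and `A` has a representation `A → M(2n, F_v)` under which the involution preserves
determinants. The resulting determinant on `M(2, A)` is `1` on Bruhat elements
(`SLStar.blockDet_eq_one`), but `SL_*(2, A)` contains an element whose component at `v` is a
reflection, of determinant `-1` (`SLStar.blockDet_reflection`).

To find `v`, it suffices to have a nonarchimedean absolute value and an `x` with
`|D x² - 1| < |4|`, by Hensel's lemma. For `x = 4 m s`, with `m` a denominator of `D` and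
`s` in `ℤ` or `𝔽_p[t]`, the norm of `1 - D x²` is a nonconstant polynomial in `s`. It is not
always one of the finitely many units, so that `1 - D x²` lies in some prime, which is prime to `2`.

**Characteristic two.** The Bruhat elements generate as soon as, whenever `(a, c)` is the first
column of an element of `SL_*(2, A)`, there is a symmetric `s` with `a + s c` invertible
(`SLStar.closure_bruhatElements_eq_top`). For matrices over a quaternion algebra over a
field of characteristic two such an `s` is found by decreasing the right annihilator of `a` step
by step: `s` is a sum of terms `r^* q r`, with `q` a symmetric element generating a minimal
right ideal (`exists_congruenceSums_isUnit_add_mul`). Such a `q` exists both for division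
algebras and for split ones; in the split case it has square zero, and symmetry of `x y x̄`, where
`x x̄ = 0`, uses `-1 = 1`.
Over a local ring, `s` is lifted from the residue field
(`exists_isUnit_add_mul_of_isLocalRing`). Over the adeles, one uses the local ring `F_v`
at finitely many places and its ring of integers, with integral solutions, at the others
(`AdeleRing.exists_isUnit_add_mul`).
-/

open scoped Quaternion TensorProduct

/-! ### Generation by Bruhat elements -/

namespace SLStar

variable {A : Type*} [Ring A] [StarRing A]

theorem star_mul_eq_left (g : SLStar A) :
    star (g.1.1 0 0) * g.1.1 1 0 = star (g.1.1 1 0) * g.1.1 0 0 := by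
  have h := congrFun (congrFun ((mem_SLStar_iff A g.1).1 g.2) 0) 0
  simp [Matrix.mul_apply, Fin.sum_univ_two, Matrix.star_apply] at h
  rw [neg_add_eq_sub, sub_eq_zero] at h
  exact h

theorem star_mul_sub_eq_one (g : SLStar A) :
    star (g.1.1 0 0) * g.1.1 1 1 - star (g.1.1 1 0) * g.1.1 0 1 = 1 := by
  have h := congrFun (congrFun ((mem_SLStar_iff A g.1).1 g.2) 0) 1
  simp [Matrix.mul_apply, Fin.sum_univ_two, Matrix.star_apply] at h
  rw [← h]; abel

theorem star_mul_eq_right (g : SLStar A) :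
    star (g.1.1 0 1) * g.1.1 1 1 = star (g.1.1 1 1) * g.1.1 0 1 := by
  have h := congrFun (congrFun ((mem_SLStar_iff A g.1).1 g.2) 1) 1
  simp [Matrix.mul_apply, Fin.sum_univ_two, Matrix.star_apply] at h
  rw [neg_add_eq_sub, sub_eq_zero] at h
  exact h

variable (A) in
/-- The subgroup generated by the Bruhat elements. -/
abbrev bruhatSubgroup : Subgroup (SLStar A) := Subgroup.closure (bruhatElements A)

theorem bruhatH_mem (a : Aˣ) : bruhatH A a ∈ bruhatSubgroup A :=
  Subgroup.subset_closure (Or.inl (Or.inl ⟨a, rfl⟩))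

theorem bruhatU_mem (b : A) (hb : star b = b) : bruhatU A b hb ∈ bruhatSubgroup A :=
  Subgroup.subset_closure (Or.inl (Or.inr ⟨b, hb, rfl⟩))

theorem bruhatW_mem : bruhatW A ∈ bruhatSubgroup A :=
  Subgroup.subset_closure (Or.inr rfl)

theorem mem_of_upper_unipotent (g : SLStar A) (h00 : g.1.1 0 0 = 1) (h10 : g.1.1 1 0 = 0) :
    g ∈ bruhatSubgroup A := by
  have h11 : g.1.1 1 1 = 1 := by
    simpa [h00, h10] using star_mul_sub_eq_one g
  have hs : star (g.1.1 0 1) = g.1.1 0 1 := by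
    simpa [h11] using star_mul_eq_right g
  have : g = bruhatU A (g.1.1 0 1) hs := by
    apply Subtype.ext; apply Units.ext
    ext i j; fin_cases i <;> fin_cases j <;> simp [bruhatU, h00, h10, h11]
  rw [this]
  exact bruhatU_mem _ _

theorem mem_of_upper_triangular (g : SLStar A) (h00 : IsUnit (g.1.1 0 0)) (h10 : g.1.1 1 0 = 0) :
    g ∈ bruhatSubgroup A := by
  obtain ⟨u, hu⟩ := h00
  have h := mem_of_upper_unipotent ((bruhatH A (star u))⁻¹ * g)
    (by simp [bruhatH, Matrix.mul_apply, Fin.sum_univ_two, ← hu, h10,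
      ← Units.coe_star_inv])
    (by simp [bruhatH, Matrix.mul_apply, Fin.sum_univ_two, h10])
  exact (Subgroup.mul_mem_cancel_left _ (Subgroup.inv_mem _ (bruhatH_mem _))).1 h

/-- An element whose upper left corner is a unit has a factorisation
`lower unipotent * diagonal * upper unipotent`. -/
theorem mem_of_isUnit (g : SLStar A) (h00 : IsUnit (g.1.1 0 0)) : g ∈ bruhatSubgroup A := by
  obtain ⟨u, hu⟩ := h00
  have hx : star (g.1.1 1 0 * (u⁻¹).1) = g.1.1 1 0 * (u⁻¹).1 := by
    have h := star_mul_eq_left g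
    rw [← hu] at h
    rw [star_mul, ← Units.coe_star, star_inv]
    rw [Units.inv_mul_eq_iff_eq_mul, ← mul_assoc, Units.coe_star, h, mul_assoc, Units.mul_inv,
      mul_one]
  have h := mem_of_upper_triangular (bruhatW A * bruhatU A _ hx * (bruhatW A)⁻¹ * g)
    (by simp [bruhatW, bruhatU, Matrix.mul_apply, Fin.sum_univ_two, ← hu])
    (by simp [bruhatW, bruhatU, Matrix.mul_apply, Fin.sum_univ_two, ← hu])
  exact (Subgroup.mul_mem_cancel_left _ (Subgroup.mul_mem _ (Subgroup.mul_mem _ bruhatW_mem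
    (bruhatU_mem _ _)) (Subgroup.inv_mem _ bruhatW_mem))).1 h

/-- If the first column of every element can be brought to one with a unit on top by adding a
symmetric multiple of the lower entry, then the Bruhat elements generate. -/
theorem closure_bruhatElements_eq_top
    (h : ∀ a c x y : A, star a * c = star c * a → x * a + y * c = 1 →
      ∃ s, star s = s ∧ IsUnit (a + s * c)) :
    Subgroup.closure (bruhatElements A) = ⊤ := by
  rw [eq_top_iff]
  rintro g -
  have hinv := congrFun (congrFun g.1.inv_mul 0) 0
  simp only [Matrix.mul_apply, Fin.sum_univ_two, Matrix.one_apply_eq] at hinv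
  obtain ⟨s, hs, hu⟩ := h _ _ _ _ (star_mul_eq_left g) hinv
  have := mem_of_isUnit (bruhatU A s hs * g)
    (by simpa [bruhatU, Matrix.mul_apply, Fin.sum_univ_two] using hu)
  exact (Subgroup.mul_mem_cancel_left _ (bruhatU_mem _ _)).1 this

/-! ### A determinant that is trivial on Bruhat elements -/

section Det

variable {m K : Type*} [Fintype m] [DecidableEq m] [CommRing K]

/-- The homomorphism `GL(2, A) → K`, `(a b; c d) ↦ det (θ a, θ b; θ c, θ d)`, for a matrix
representation `θ` of `A`. -/
noncomputable def blockDet {A : Type*} [Ring A] (θ : A →+* Matrix m m K) :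
    Matrix (Fin 2) (Fin 2) A →* K where
  toFun g := (Matrix.fromBlocks (θ (g 0 0)) (θ (g 0 1)) (θ (g 1 0)) (θ (g 1 1))).det
  map_one' := by simp
  map_mul' g h := by
    rw [← Matrix.det_mul, Matrix.fromBlocks_multiply]
    simp [Matrix.mul_apply, Fin.sum_univ_two]

theorem blockDet_apply {A : Type*} [Ring A] (θ : A →+* Matrix m m K) (g : Matrix (Fin 2) (Fin 2) A) :
    blockDet θ g =
      (Matrix.fromBlocks (θ (g 0 0)) (θ (g 0 1)) (θ (g 1 0)) (θ (g 1 1))).det := rfl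

/-- If `θ` turns the involution into one preserving determinants, then `blockDet θ` is trivial on
the subgroup generated by the Bruhat elements. -/
theorem blockDet_eq_one (θ : A →+* Matrix m m K) (hθ : ∀ a, (θ (star a)).det = (θ a).det)
    {g : SLStar A} (hg : g ∈ Subgroup.closure (bruhatElements A)) : blockDet θ g.1.1 = 1 := by
  have hle : Subgroup.closure (bruhatElements A) ≤
      (((Units.map (blockDet θ)).comp (SLStar A).subtype)).ker := by
    rw [Subgroup.closure_le]
    rintro g ((⟨a, rfl⟩ | ⟨b, hb, rfl⟩) | rfl) <;>
      simp only [SetLike.mem_coe, MonoidHom.mem_ker, MonoidHom.coe_comp, Function.comp_apply,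
        Subgroup.coe_subtype, Units.ext_iff, Units.coe_map, Units.val_one]
    · simp only [blockDet_apply, bruhatH, Matrix.of_apply, Matrix.cons_val', Matrix.cons_val_zero,
        Matrix.cons_val_one, Matrix.cons_val_fin_one, map_zero]
      rw [Matrix.det_fromBlocks_zero₂₁, hθ, ← Matrix.det_mul, ← map_mul, Units.mul_inv, map_one,
        Matrix.det_one]
    · simp [blockDet_apply, bruhatU]
    · -- `ω` is a product of three elementary unipotent matrices
      have hw : (bruhatW A).1.1 = !![1, 1; 0, 1] * !![1, 0; -1, 1] * !![1, 1; 0, 1] := by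
        ext i j; fin_cases i <;> fin_cases j <;> simp [bruhatW, Matrix.mul_apply, Fin.sum_univ_two]
      rw [hw, map_mul, map_mul]
      simp [blockDet_apply]
  have := hle hg
  simpa [MonoidHom.mem_ker, Units.ext_iff] using this

end Det

/-! ### A reflection -/

/-- A system of `2 × 2` matrix units of a corner of `A` on which the involution of `A` is the
adjugate of `2 × 2` matrices. -/
structure AdjugateUnits (e₁₁ e₁₂ e₂₁ e₂₂ : A) : Prop where
  mul_11_11 : e₁₁ * e₁₁ = e₁₁
  mul_11_12 : e₁₁ * e₁₂ = e₁₂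
  mul_11_21 : e₁₁ * e₂₁ = 0
  mul_11_22 : e₁₁ * e₂₂ = 0
  mul_12_11 : e₁₂ * e₁₁ = 0
  mul_12_12 : e₁₂ * e₁₂ = 0
  mul_12_21 : e₁₂ * e₂₁ = e₁₁
  mul_12_22 : e₁₂ * e₂₂ = e₁₂
  mul_21_11 : e₂₁ * e₁₁ = e₂₁
  mul_21_12 : e₂₁ * e₁₂ = e₂₂
  mul_21_21 : e₂₁ * e₂₁ = 0
  mul_21_22 : e₂₁ * e₂₂ = 0
  mul_22_11 : e₂₂ * e₁₁ = 0
  mul_22_12 : e₂₂ * e₁₂ = 0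
  mul_22_21 : e₂₂ * e₂₁ = e₂₁
  mul_22_22 : e₂₂ * e₂₂ = e₂₂
  star_11 : star e₁₁ = e₂₂
  star_12 : star e₁₂ = -e₁₂
  star_21 : star e₂₁ = -e₂₁
  star_22 : star e₂₂ = e₁₁

variable {e₁₁ e₁₂ e₂₁ e₂₂ : A}

theorem AdjugateUnits.map {B : Type*} [Ring B] [StarRing B] (φ : A →ₙ+* B)
    (hφ : ∀ x, φ (star x) = star (φ x)) (h : AdjugateUnits e₁₁ e₁₂ e₂₁ e₂₂) :
    AdjugateUnits (φ e₁₁) (φ e₁₂) (φ e₂₁) (φ e₂₂) := by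
  obtain ⟨h1, h2, h3, h4, h5, h6, h7, h8, h9, h10, h11, h12, h13, h14, h15, h16, h17, h18, h19,
    h20⟩ := h
  constructor <;> simp only [← map_mul, ← hφ, ← map_neg, *, map_zero]

/-- The reflection in `SL_*(2, A)` attached to a system of adjugate matrix units: it is the
identity outside a `4 × 4` block, where it interchanges two basis vectors. -/
def reflection (h : AdjugateUnits e₁₁ e₁₂ e₂₁ e₂₂) : SLStar A :=
  ⟨⟨!![1 - e₂₂, e₂₁; e₁₂, 1 - e₁₁], !![1 - e₂₂, e₂₁; e₁₂, 1 - e₁₁],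
    by
      rw [Matrix.one_fin_two, Matrix.mul_fin_two]
      simp [mul_sub, sub_mul, h.mul_22_22, h.mul_21_12, h.mul_22_21, h.mul_21_11, h.mul_12_22,
        h.mul_11_12, h.mul_12_21, h.mul_11_11],
    by
      rw [Matrix.one_fin_two, Matrix.mul_fin_two]
      simp [mul_sub, sub_mul, h.mul_22_22, h.mul_21_12, h.mul_22_21, h.mul_21_11, h.mul_12_22,
        h.mul_11_12, h.mul_12_21, h.mul_11_11]⟩, by
    rw [mem_SLStar_iff]
    ext i j; fin_cases i <;> fin_cases j <;>
      simp [Matrix.mul_apply, Fin.sum_univ_two, Matrix.star_apply, mul_sub, sub_mul, add_mul, h.star_11,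
        h.star_12, h.star_21, h.star_22, h.mul_11_12, h.mul_12_22, h.mul_11_11, h.mul_12_21,
        h.mul_21_12, h.mul_22_22, h.mul_21_11, h.mul_22_21]⟩

/-- A representation that sends the adjugate units to elementary matrices sends the reflection to
the identity plus a matrix of rank one, of determinant `-1`. -/
theorem blockDet_reflection {m K : Type*} [Fintype m] [DecidableEq m] [CommRing K]
    (θ : A →+* Matrix m m K) (h : AdjugateUnits e₁₁ e₁₂ e₂₁ e₂₂) (i j : m)
    (h11 : θ e₁₁ = Matrix.single i i 1) (h12 : θ e₁₂ = Matrix.single i j 1)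
    (h21 : θ e₂₁ = Matrix.single j i 1) (h22 : θ e₂₂ = Matrix.single j j 1) :
    blockDet θ (reflection h).1.1 = -1 := by
  have key : Matrix.fromBlocks (1 - Matrix.single j j (1 : K)) (Matrix.single j i 1)
      (Matrix.single i j 1) (1 - Matrix.single i i (1 : K)) =
      1 + Matrix.replicateCol Unit (Sum.elim (Pi.single j (1 : K)) (-Pi.single i 1)) *
        Matrix.replicateRow Unit (Sum.elim (-Pi.single j (1 : K)) (Pi.single i 1)) := by
    ext (x | x) (y | y) <;>
      simp [Matrix.single_apply, Matrix.one_apply, Matrix.mul_apply, Pi.single_apply] <;>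
      grind
  rw [blockDet_apply]
  simp only [reflection, Matrix.of_apply, Matrix.cons_val', Matrix.cons_val_zero,
        Matrix.cons_val_one, Matrix.cons_val_fin_one, map_sub, map_one, h11, h12, h21, h22]
  rw [key, Matrix.det_one_add_mul_comm]
  simp [Matrix.det_unique, Matrix.mul_apply, Pi.single_apply]

end SLStar

/-! ### Symmetric stable range for prime algebras with involution -/

section StableRange

variable {B : Type*} [Ring B] [StarRing B]

/-- The sums of elements `star r * q * r`. They are symmetric if `q` is. -/
def congruenceSums (q : B) : AddSubmonoid B :=
  AddSubmonoid.closure (Set.range fun r => star r * q * r)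

theorem star_eq_of_mem_congruenceSums {q s : B} (hq : star q = q) (hs : s ∈ congruenceSums q) :
    star s = s := by
  induction hs using AddSubmonoid.closure_induction with
  | mem x hx => obtain ⟨r, rfl⟩ := hx; simp [mul_assoc, hq]
  | zero => simp
  | add x y _ _ hx hy => rw [star_add, hx, hy]

/-- A replacement, for involutions, of the fact that finite-dimensional algebras have stable
range one. The hypothesis `hmin` says that the right ideal `q B` is minimal. While the right
annihilator of `a` is nonzero, adding to `a` a suitable term `(star r * q * r) * c` shrinks it. -/
theorem exists_congruenceSums_isUnit_add_mul (K : Type*) [Field K] [Algebra K B]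
    [FiniteDimensional K B] (hprime : ∀ x y : B, (∀ r, x * r * y = 0) → x = 0 ∨ y = 0)
    {q : B} (hq : star q = q) (hq0 : q ≠ 0) (hmin : ∀ t, q * t ≠ 0 → ∃ t', q * t * t' = q)
    {a c x y : B} (hac : star a * c = star c * a) (hxy : x * a + y * c = 1) :
    ∃ s ∈ congruenceSums q, IsUnit (a + s * c) := by
  induction hd : Module.finrank K (LinearMap.mulLeft K a).ker using Nat.strong_induction_on
    generalizing a y with
  | _ d ih =>
    by_cases hker : (LinearMap.mulLeft K a).ker = ⊥
    · refine ⟨0, zero_mem _, ?_⟩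
      have hinj : Function.Injective (LinearMap.mulLeft K a) := LinearMap.ker_eq_bot.1 hker
      obtain ⟨b, hb⟩ := (LinearMap.injective_iff_surjective.1 hinj) 1
      have hab : a * b = 1 := hb
      have hba : b * a = 1 := hinj (by
        change a * (b * a) = a * 1
        rw [← mul_assoc, hab, one_mul, mul_one])
      rw [zero_mul, add_zero]
      exact ⟨⟨a, b, hab, hba⟩, rfl⟩
    · obtain ⟨x₀, hx₀, hx₀0⟩ := (Submodule.ne_bot_iff _).1 hker
      replace hx₀ : a * x₀ = 0 := hx₀
      have hcx : c * x₀ ≠ 0 := fun h0 => hx₀0 (by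
        rw [← one_mul x₀, ← hxy, add_mul, mul_assoc, mul_assoc, hx₀, h0, mul_zero, mul_zero,
          add_zero])
      obtain ⟨r, hr⟩ : ∃ r, q * r * (c * x₀) ≠ 0 := by
        by_contra! hcon
        exact (hprime _ _ hcon).elim hq0 hcx
      set s := star r * q * r with hs
      have hsmem : s ∈ congruenceSums q := AddSubmonoid.subset_closure ⟨r, rfl⟩
      have hss : star s = s := star_eq_of_mem_congruenceSums hq hsmem
      have hle : (LinearMap.mulLeft K (a + s * c)).ker ≤ (LinearMap.mulLeft K a).ker := by
        intro z hz
        replace hz : (a + s * c) * z = 0 := hz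
        change a * z = 0
        by_cases hqz : q * (r * c * z) = 0
        · rwa [add_mul, hs, show star r * q * r * c * z = star r * (q * (r * c * z)) by
            simp only [mul_assoc], hqz, mul_zero, add_zero] at hz
        · exfalso
          -- minimality puts `star r * q` into the image of `a`, which is orthogonal to `c * x₀`
          obtain ⟨t, ht⟩ := hmin _ hqz
          have h1 : a * (z * t) = -(star r * q) := by
            rw [eq_neg_iff_add_eq_zero, ← ht]
            calc _ = (a + s * c) * z * t := by rw [hs]; noncomm_ring
              _ = 0 := by rw [hz, zero_mul]
          have h2 := congrArg star h1
          simp only [star_mul, star_neg, star_star, hq] at h2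
          apply hr
          rw [← neg_eq_zero, ← neg_mul, ← h2]
          calc _ = star t * star z * (star a * c) * x₀ := by simp only [mul_assoc]
            _ = star t * star z * star c * (a * x₀) := by rw [hac]; simp only [mul_assoc]
            _ = 0 := by rw [hx₀, mul_zero]
      have hlt : (LinearMap.mulLeft K (a + s * c)).ker < (LinearMap.mulLeft K a).ker := by
        refine lt_of_le_of_ne hle fun heq => ?_
        have hmem : x₀ ∈ (LinearMap.mulLeft K (a + s * c)).ker := by
          rw [heq]; exact hx₀
        replace hmem : (a + s * c) * x₀ = 0 := hmem
        rw [add_mul, hx₀, zero_add, hs] at hmem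
        have h0 : q * (r * c * x₀) ≠ 0 := by simpa only [mul_assoc] using hr
        obtain ⟨t, ht⟩ := hmin _ h0
        have h1 : star r * q = 0 := by
          rw [← ht, show star r * (q * (r * c * x₀) * t) = star r * q * r * c * x₀ * t by
            simp only [mul_assoc], hmem, zero_mul]
        have h2 := congrArg star h1
        rw [star_mul, star_star, hq, star_zero] at h2
        rw [h2, zero_mul] at hr
        exact hr rfl
      have hac' : star (a + s * c) * c = star c * (a + s * c) := by
        rw [star_add, star_mul, hss, add_mul, mul_add, hac, mul_assoc]
      obtain ⟨s', hs', hu⟩ := ih _ (hd ▸ Submodule.finrank_lt_finrank_of_lt hlt) (y := y - x * s)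
        hac' (by rw [← hxy]; noncomm_ring) rfl
      exact ⟨s + s', add_mem hsmem hs', by rwa [add_mul, ← add_assoc]⟩

end StableRange

/-! ### Quaternion algebras in characteristic two -/

namespace QuaternionAlgebra

variable {K : Type*} [Field K] {a b c : K}

theorem isUnit_of_norm_ne_zero {x : ℍ[K,a,b,c]} (hx : x * star x ≠ 0) : IsUnit x := by
  have h1 := mul_star_eq_coe x
  have h2 := star_mul_eq_coe x
  have h3 : (star x * x).re = (x * star x).re := by simp; ring
  set N := (x * star x).re
  have hN : N ≠ 0 := fun h0 => hx (by rw [h1, h0, coe_zero])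
  rw [h3] at h2
  refine ⟨⟨x, N⁻¹ • star x, ?_, ?_⟩, rfl⟩
  · rw [mul_smul_comm, h1, smul_coe, inv_mul_cancel₀ hN, coe_one]
  · rw [smul_mul_assoc, h2, smul_coe, inv_mul_cancel₀ hN, coe_one]

/-- In characteristic two, a quaternion algebra over a field is a prime ring. -/
theorem eq_zero_or_eq_zero_of_mul_mul [CharP K 2] (hb : b ≠ 0) (hc : c ≠ 0) (x y : ℍ[K,a,b,c])
    (h : ∀ r, x * r * y = 0) : x = 0 ∨ y = 0 := by
  by_contra! hne
  obtain ⟨hx, hy⟩ := hne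
  have h2 : (2 : K) = 0 := CharTwo.two_eq_zero
  -- The two-sided ideal of all `z` with `z * r * y = 0` for every `r` contains no nonzero scalar.
  let I : ℍ[K,a,b,c] → Prop := fun z => ∀ r, z * r * y = 0
  have hadd : ∀ z w, I z → I w → I (z + w) := fun z w hz hw r => by
    rw [add_mul, add_mul, hz, hw, add_zero]
  have hl : ∀ l z, I z → I (l * z) := fun l z hz r => by
    rw [mul_assoc l, mul_assoc l, hz, mul_zero]
  have hr : ∀ r z, I z → I (z * r) := fun r z hz s => by rw [mul_assoc z, hz]
  have hsc : ∀ t : K, I t → t = 0 := fun t ht => by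
    have h1 := ht 1
    rw [mul_one, coe_mul_eq_smul] at h1
    exact (smul_eq_zero.1 h1).resolve_right hy
  have hL : ∀ p q : K, I ⟨p, q, 0, 0⟩ → p = 0 ∧ q = 0 := by
    intro p q hpq
    -- conjugation by `j` produces the reduced trace of `p + q i`
    have hq : q = 0 := by
      have h1 := hsc (c * b * q) (by
        convert hadd _ _ (hr ⟨0, 0, 1, 0⟩ _ (hl ⟨0, 0, 1, 0⟩ _ hpq)) (hl (c : ℍ[K,a,b,c]) _ hpq)
          using 1
        ext <;> simp
        linear_combination (-c * p) * h2)
      simpa [hb, hc] using h1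
    subst hq
    exact ⟨hsc p hpq, rfl⟩
  -- the commutator with `i` isolates the part of `x` along `j` and `k`
  have hJK : I ⟨0, 0, x.imJ, x.imK⟩ := by
    convert hl ((b⁻¹ : K) : ℍ[K,a,b,c]) _ (hadd _ _ (hl ⟨0, 1, 0, 0⟩ _ h) (hr ⟨0, 1, 0, 0⟩ _ h))
      using 1
    ext <;> simp [hb, -mul_eq_zero, -zero_eq_mul]
    · linear_combination (-b⁻¹ * a * x.imI) * h2
    · linear_combination (-b⁻¹ * (x.re + b * x.imI)) * h2
  have hJK' := hL _ _ (by
    convert hr ⟨0, 0, 1, 0⟩ _ hJK using 1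
    show (⟨c * x.imJ, c * x.imK, 0, 0⟩ : ℍ[K,a,b,c]) = _
    ext <;> simp)
  have hRI := hL _ _ (by
    convert hadd _ _ h hJK using 1
    show (⟨x.re, x.imI, 0, 0⟩ : ℍ[K,a,b,c]) = _
    ext
    · simp
    · simp
    · simp only [imJ_add]; linear_combination (-x.imJ) * h2
    · simp only [imK_add]; linear_combination (-x.imK) * h2)
  apply hx
  ext <;> simp_all

/-- In characteristic two, a quaternion algebra over a field has a nonzero symmetric element
generating a minimal right ideal: `1` if it is a division algebra, and an element of square zero
otherwise. -/
theorem exists_symmetric_minimal [CharP K 2] (hb : b ≠ 0) (hc : c ≠ 0) :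
    ∃ q : ℍ[K,a,b,c], star q = q ∧ q ≠ 0 ∧ ∀ t, q * t ≠ 0 → ∃ t', q * t * t' = q := by
  by_cases hdiv : ∀ x : ℍ[K,a,b,c], x ≠ 0 → x * star x ≠ 0
  · refine ⟨1, star_one _, one_ne_zero, fun t ht => ?_⟩
    rw [one_mul] at ht ⊢
    exact (isUnit_of_norm_ne_zero (hdiv t ht)).exists_right_inv
  · push Not at hdiv
    obtain ⟨x, hx, hxx⟩ := hdiv
    have h2 : (2 : K) = 0 := CharTwo.two_eq_zero
    have hneg : ∀ z : ℍ[K,a,b,c], -z = z := fun z => by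
      rw [neg_eq_iff_add_eq_zero, ← two_smul K, h2, zero_smul]
    obtain ⟨y, hy⟩ : ∃ y, x * y * star x ≠ 0 := by
      by_contra! hcon
      exact (eq_zero_or_eq_zero_of_mul_mul hb hc _ _ hcon).elim hx (fun h => hx (by simpa using h))
    set q := x * y * star x with hq
    have hqs : star q = q := by
      rw [hq, star_mul, star_mul, star_star, star_eq_two_re_sub y, sub_mul, mul_sub, coe_commutes,
        ← mul_assoc, hxx, zero_mul, zero_sub, hneg, mul_assoc]
    refine ⟨q, hqs, hy, ?_⟩
    intro t ht
    obtain ⟨w, hw⟩ : ∃ w, q * t * w * q ≠ 0 := by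
      by_contra! hcon
      exact (eq_zero_or_eq_zero_of_mul_mul hb hc _ _ hcon).elim ht hy
    have hqq : q * q = 0 := by
      have hxx' : star x * x = 0 := by
        rw [mul_star_eq_coe, ← coe_zero, coe_inj] at hxx
        rw [star_mul_eq_coe, ← coe_zero, coe_inj, ← hxx]
        simp; ring
      rw [hq, show x * y * star x * (x * y * star x) = x * y * (star x * x) * (y * star x) by
        simp only [mul_assoc], hxx', mul_zero, zero_mul]
    -- `q * z * q` is a scalar multiple of `q`, the factor being the reduced trace of `z * q`
    have hz := star_eq_two_re_sub (t * w * q)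
    rw [star_mul, hqs, eq_sub_iff_add_eq] at hz
    have hz' := congrArg (q * ·) hz
    simp only [mul_add] at hz'
    rw [← mul_assoc q q, hqq, zero_mul, zero_add, mul_coe_eq_smul] at hz'
    set l := 2 * (t * w * q).re + b * (t * w * q).imI
    have hl : l ≠ 0 := fun h0 => hw (by
      rw [mul_assoc q, mul_assoc q, hz', h0, zero_smul])
    refine ⟨l⁻¹ • (w * q), ?_⟩
    rw [mul_smul_comm, mul_assoc, ← mul_assoc t, hz', smul_smul, inv_mul_cancel₀ hl, one_smul]

/-- The map of quaternion algebras induced by a ring homomorphism, the structure constants of the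
target being given separately. -/
def mapHom {R S : Type*} [CommRing R] [CommRing S] (φ : R →+* S) {a b c : R} {a' b' c' : S}
    (ha : φ a = a') (hb : φ b = b') (hc : φ c = c') : ℍ[R,a,b,c] →+* ℍ[S,a',b',c'] where
  toFun x := ⟨φ x.re, φ x.imI, φ x.imJ, φ x.imK⟩
  map_one' := by ext <;> simp
  map_zero' := by ext <;> simp
  map_add' x y := by ext <;> simp
  map_mul' x y := by subst ha hb hc; ext <;> simp

section mapHom

variable {R S : Type*} [CommRing R] [CommRing S] (φ : R →+* S) {a b c : R} {a' b' c' : S}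
    (ha : φ a = a') (hb : φ b = b') (hc : φ c = c')

theorem mapHom_apply (x : ℍ[R,a,b,c]) :
    mapHom φ ha hb hc x = ⟨φ x.re, φ x.imI, φ x.imJ, φ x.imK⟩ := rfl

theorem mapHom_star (x : ℍ[R,a,b,c]) : mapHom φ ha hb hc (star x) = star (mapHom φ ha hb hc x) := by
  subst ha hb hc; ext <;> simp [mapHom_apply]

theorem mapHom_surjective (hφ : Function.Surjective φ) :
    Function.Surjective (mapHom φ ha hb hc) := fun ⟨x, y, z, w⟩ => by
  obtain ⟨x, rfl⟩ := hφ x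
  obtain ⟨y, rfl⟩ := hφ y
  obtain ⟨z, rfl⟩ := hφ z
  obtain ⟨w, rfl⟩ := hφ w
  exact ⟨⟨x, y, z, w⟩, rfl⟩

end mapHom

end QuaternionAlgebra

namespace Matrix

variable {ι Q : Type*} [Fintype ι] [DecidableEq ι] [Ring Q]

theorem eq_zero_or_eq_zero_of_mul_mul (hQ : ∀ x y : Q, (∀ r, x * r * y = 0) → x = 0 ∨ y = 0)
    (X Y : Matrix ι ι Q) (h : ∀ T, X * T * Y = 0) : X = 0 ∨ Y = 0 := by
  by_contra! hne
  obtain ⟨hX, hY⟩ := hne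
  obtain ⟨i, j, hij⟩ : ∃ i j, X i j ≠ 0 := by
    by_contra! hcon
    exact hX (Matrix.ext hcon)
  obtain ⟨k, l, hkl⟩ : ∃ i j, Y i j ≠ 0 := by
    by_contra! hcon
    exact hY (Matrix.ext hcon)
  refine (hQ _ _ fun r => ?_).elim hij hkl
  have := congrFun (congrFun (h (single j k r)) i) l
  simpa [Matrix.mul_apply, single_apply, ite_and, Finset.sum_ite_eq] using this

theorem exists_single_mul_mul_eq {q : Q} (hq : ∀ t, q * t ≠ 0 → ∃ t', q * t * t' = q) (i : ι)
    (T : Matrix ι ι Q) (hT : single i i q * T ≠ 0) : ∃ T', single i i q * T * T' = single i i q := by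
  obtain ⟨j, hj⟩ : ∃ j, q * T i j ≠ 0 := by
    by_contra! hcon
    refine hT (Matrix.ext fun k l => ?_)
    rcases eq_or_ne k i with rfl | hk
    · simpa using hcon l
    · simp [hk]
  obtain ⟨t', ht'⟩ := hq _ hj
  refine ⟨single j i t', Matrix.ext fun k l => ?_⟩
  rcases eq_or_ne k i with rfl | hk
  · rcases eq_or_ne l k with rfl | hl
    · simp [ht']
    · simp [hl, hl.symm]
  · simp [mul_assoc, hk, hk.symm]

theorem mapMatrix_star {Q' : Type*} [Ring Q'] [StarRing Q] [StarRing Q'] (φ : Q →+* Q')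
    (hφ : ∀ x, φ (star x) = star (φ x)) (X : Matrix ι ι Q) :
    φ.mapMatrix (star X) = star (φ.mapMatrix X) := by
  ext i j
  simp [Matrix.star_apply, hφ]

end Matrix

/-! ### Symmetric stable range over local rings -/

section LocalRing

variable {O : Type*} [CommRing O] [IsLocalRing O] {a b c : O} {ι : Type*} [Fintype ι]
  [DecidableEq ι]

open IsLocalRing

/-- Reduction of matrices of quaternions modulo the maximal ideal. -/
noncomputable def quaternionResidue (O : Type*) [CommRing O] [IsLocalRing O] (a b c : O)
    (ι : Type*) [Fintype ι] [DecidableEq ι] : Matrix ι ι ℍ[O,a,b,c] →+*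
      Matrix ι ι ℍ[ResidueField O, residue O a, residue O b, residue O c] :=
  (QuaternionAlgebra.mapHom (residue O) rfl rfl rfl).mapMatrix

theorem quaternionResidue_star (X : Matrix ι ι ℍ[O,a,b,c]) :
    quaternionResidue O a b c ι (star X) = star (quaternionResidue O a b c ι X) :=
  Matrix.mapMatrix_star _ (QuaternionAlgebra.mapHom_star _ _ _ _) X

theorem quaternionResidue_surjective : Function.Surjective (quaternionResidue O a b c ι) := by
  intro Y
  choose f hf using QuaternionAlgebra.mapHom_surjective (residue O) (rfl : _ = residue O a)
    (rfl : _ = residue O b) (rfl : _ = residue O c) residue_surjective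
  exact ⟨Matrix.of fun i j => f (Y i j), Matrix.ext fun i j => hf _⟩

theorem mem_smul_top_of_quaternionResidue_eq_zero {Z : Matrix ι ι ℍ[O,a,b,c]}
    (hZ : quaternionResidue O a b c ι Z = 0) :
    Z ∈ maximalIdeal O • (⊤ : Submodule O (Matrix ι ι ℍ[O,a,b,c])) := by
  rw [Matrix.matrix_eq_sum_single Z]
  refine Submodule.sum_mem _ fun i _ => Submodule.sum_mem _ fun j _ => ?_
  have hij : (⟨residue O (Z i j).re, residue O (Z i j).imI, residue O (Z i j).imJ,
      residue O (Z i j).imK⟩ : ℍ[ResidueField O, residue O a, residue O b, residue O c]) = 0 :=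
    congrFun (congrFun hZ i) j
  rw [QuaternionAlgebra.ext_iff] at hij
  simp only [QuaternionAlgebra.re_zero, QuaternionAlgebra.imI_zero, QuaternionAlgebra.imJ_zero,
    QuaternionAlgebra.imK_zero, residue_eq_zero_iff] at hij
  obtain ⟨h1, h2, h3, h4⟩ := hij
  have : Matrix.single i j (Z i j) = (Z i j).re • Matrix.single i j 1 +
      (Z i j).imI • Matrix.single i j ⟨0, 1, 0, 0⟩ + (Z i j).imJ • Matrix.single i j ⟨0, 0, 1, 0⟩ +
      (Z i j).imK • Matrix.single i j ⟨0, 0, 0, 1⟩ := by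
    simp only [Matrix.smul_single, ← Matrix.single_add]
    congr 1
    ext <;> simp
  rw [this]
  exact add_mem (add_mem (add_mem (Submodule.smul_mem_smul h1 trivial)
    (Submodule.smul_mem_smul h2 trivial)) (Submodule.smul_mem_smul h3 trivial))
    (Submodule.smul_mem_smul h4 trivial)

/-- Units lift from the residue field, by Nakayama's lemma. -/
theorem isUnit_of_isUnit_quaternionResidue {X : Matrix ι ι ℍ[O,a,b,c]}
    (hX : IsUnit (quaternionResidue O a b c ι X)) : IsUnit X := by
  obtain ⟨Y, hY⟩ := hX.exists_right_inv
  obtain ⟨Y, rfl⟩ := quaternionResidue_surjective Y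
  have hsurj : Function.Surjective (LinearMap.mulLeft O X) := by
    rw [← LinearMap.range_eq_top, eq_top_iff]
    refine Submodule.le_of_le_smul_of_le_jacobson_bot (Module.Finite.fg_top)
      (maximalIdeal_le_jacobson _) fun Z _ => ?_
    have h1 : X * (Y * Z) ∈ (LinearMap.mulLeft O X).range := ⟨Y * Z, rfl⟩
    have h2 : Z - X * (Y * Z) ∈ maximalIdeal O • (⊤ : Submodule O (Matrix ι ι ℍ[O,a,b,c])) :=
      mem_smul_top_of_quaternionResidue_eq_zero (by
        rw [map_sub, map_mul, map_mul, ← mul_assoc, hY, one_mul, sub_self])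
    have := Submodule.add_mem_sup h1 h2
    rwa [add_sub_cancel] at this
  have hinj := OrzechProperty.injective_of_surjective_endomorphism _ hsurj
  obtain ⟨W, hW⟩ := hsurj 1
  replace hW : X * W = 1 := hW
  refine ⟨⟨X, W, hW, hinj ?_⟩, rfl⟩
  change X * (W * X) = X * 1
  rw [← mul_assoc, hW, one_mul, mul_one]

/-- In characteristic two, matrix rings over a quaternion algebra with invertible discriminant over
a local ring have symmetric stable range one. -/
theorem exists_isUnit_add_mul_of_isLocalRing (h2 : (2 : O) = 0) (hb : IsUnit b) (hc : IsUnit c)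
    {A C X Y : Matrix ι ι ℍ[O,a,b,c]} (hAC : star A * C = star C * A) (hXY : X * A + Y * C = 1) :
    ∃ s, star s = s ∧ IsUnit (A + s * C) := by
  rcases isEmpty_or_nonempty ι with hι | ⟨⟨i⟩⟩
  · exact ⟨0, star_zero _, isUnit_of_subsingleton _⟩
  have : CharP (ResidueField O) 2 := CharTwo.of_one_ne_zero_of_two_eq_zero one_ne_zero (by
    rw [← map_ofNat (residue O) 2, h2, map_zero])
  have hb' : residue O b ≠ 0 := (hb.map _).ne_zero
  have hc' : residue O c ≠ 0 := (hc.map _).ne_zero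
  obtain ⟨q, hqs, hq0, hqm⟩ :=
    QuaternionAlgebra.exists_symmetric_minimal (a := residue O a) hb' hc'
  obtain ⟨s, hs, hu⟩ := exists_congruenceSums_isUnit_add_mul (ResidueField O)
    (Matrix.eq_zero_or_eq_zero_of_mul_mul
      (QuaternionAlgebra.eq_zero_or_eq_zero_of_mul_mul (a := residue O a) hb' hc'))
    (q := Matrix.single i i q) (by rw [Matrix.star_eq_conjTranspose, Matrix.conjTranspose_single,
      hqs]) (fun h0 => hq0 (by simpa using congrFun (congrFun h0 i) i))
    (Matrix.exists_single_mul_mul_eq hqm i)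
    (a := quaternionResidue O a b c ι A) (c := quaternionResidue O a b c ι C)
    (x := quaternionResidue O a b c ι X) (y := quaternionResidue O a b c ι Y)
    (by rw [← quaternionResidue_star, ← quaternionResidue_star, ← map_mul, ← map_mul, hAC])
    (by rw [← map_mul, ← map_mul, ← map_add, hXY, map_one])
  -- symmetric quaternions have no `i`-coordinate, so they lift to symmetric quaternions
  obtain ⟨q', hq's, rfl⟩ : ∃ q' : ℍ[O,a,b,c], star q' = q' ∧
      QuaternionAlgebra.mapHom (residue O) rfl rfl rfl q' = q := by
    have hqI : q.imI = 0 := by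
      have := congrArg QuaternionAlgebra.re hqs
      simpa [hb'] using this
    obtain ⟨x, hx⟩ := residue_surjective q.re
    obtain ⟨y, hy⟩ := residue_surjective q.imJ
    obtain ⟨z, hz⟩ := residue_surjective q.imK
    refine ⟨⟨x, 0, y, z⟩, ?_, ?_⟩
    · ext <;> simp
      · linear_combination (-y) * h2
      · linear_combination (-z) * h2
    · ext <;> simp [QuaternionAlgebra.mapHom_apply, hx, hy, hz, hqI]
  obtain ⟨s', hs's, rfl⟩ : ∃ s', star s' = s' ∧ quaternionResidue O a b c ι s' = s := by
    clear hu
    induction hs using AddSubmonoid.closure_induction with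
    | mem s hs =>
      obtain ⟨r, rfl⟩ := hs
      obtain ⟨r, rfl⟩ := quaternionResidue_surjective r
      refine ⟨star r * Matrix.single i i q' * r, ?_, ?_⟩
      · simp only [star_mul, Matrix.star_eq_conjTranspose, Matrix.conjTranspose_single,
          hq's, mul_assoc,
          Matrix.conjTranspose_conjTranspose]
      · rw [map_mul, map_mul, quaternionResidue_star]
        congr 2
        exact Matrix.map_single _ _ _ _
    | zero => exact ⟨0, star_zero _, map_zero _⟩
    | add x y _ _ hx hy =>
      obtain ⟨x, hxs, rfl⟩ := hx
      obtain ⟨y, hys, rfl⟩ := hy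
      exact ⟨x + y, by rw [star_add, hxs, hys], map_add _ _ _⟩
  refine ⟨s', hs's, isUnit_of_isUnit_quaternionResidue ?_⟩
  rwa [map_add, map_mul]

end LocalRing

/-! ### Base change of quaternion algebras -/

/-- The quaternion algebra over an `F`-algebra `R` with structure constants in `F`. -/
abbrev QuaternionAlgebra.Over {F : Type*} [Field F] (R : Type*) [CommRing R] [Algebra F R]
    (a b c : F) : Type _ :=
  ℍ[R,algebraMap F R a,algebraMap F R b,algebraMap F R c]

open QuaternionAlgebra (Over)

section BaseChange

variable {F H : Type*} [Field F] [Ring H] [Algebra F H] {a b c : F}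

/-- For a quaternion algebra `H` with structure constants `a, b, c`, the `R`-algebra `H ⊗ R` with
its induced involution is the quaternion algebra over `R` with the same structure constants. -/
theorem QuaternionConj.exists_ringEquiv_extend [IsQuaternionAlgebra F H]
    (e : H ≃ₐ[F] ℍ[F,a,b,c]) (R : Type*) [CommRing R] [Algebra F R] :
    ∃ Ψ : H ⊗[F] R ≃+* Over R a b c,
      ∀ x, Ψ (QuaternionConj.extend F H R x) = star (Ψ x) := by
  let f : H →ₐ[F] Over R a b c := AlgHom.comp
    { QuaternionAlgebra.mapHom (algebraMap F R) rfl rfl rfl with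
      commutes' := fun r => by
        ext <;> simp [QuaternionAlgebra.mapHom_apply, QuaternionAlgebra.algebraMap_eq]
        all_goals rfl }
    e.toAlgHom
  let g : R →ₐ[F] Over R a b c := IsScalarTower.toAlgHom F R (Over R a b c)
  let Ψ : H ⊗[F] R →ₐ[F] Over R a b c := Algebra.TensorProduct.lift f g fun x r =>
    (Algebra.commutes r (f x)).symm
  have hΨ : ∀ h r, Ψ (h ⊗ₜ r) = r • (⟨algebraMap F R (e h).re, algebraMap F R (e h).imI,
      algebraMap F R (e h).imJ, algebraMap F R (e h).imK⟩ : Over R a b c) := by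
    intro h r
    rw [Algebra.smul_def, Algebra.commutes]
    exact Algebra.TensorProduct.lift_tmul _ _ _ _ _
  let κ : Over R a b c → H ⊗[F] R := fun x =>
    e.symm ⟨1, 0, 0, 0⟩ ⊗ₜ x.re + e.symm ⟨0, 1, 0, 0⟩ ⊗ₜ x.imI +
    e.symm ⟨0, 0, 1, 0⟩ ⊗ₜ x.imJ + e.symm ⟨0, 0, 0, 1⟩ ⊗ₜ x.imK
  have hκadd : ∀ x y, κ (x + y) = κ x + κ y := fun x y => by
    simp only [κ, QuaternionAlgebra.re_add, QuaternionAlgebra.imI_add, QuaternionAlgebra.imJ_add,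
      QuaternionAlgebra.imK_add, TensorProduct.tmul_add]
    abel
  have hκΨ : ∀ z, κ (Ψ z) = z := by
    intro z
    induction z using TensorProduct.induction_on with
    | zero => simp [κ]
    | add x y hx hy => rw [map_add, hκadd, hx, hy]
    | tmul h r =>
      have hh : h = (e h).re • e.symm ⟨1, 0, 0, 0⟩ + (e h).imI • e.symm ⟨0, 1, 0, 0⟩ +
          (e h).imJ • e.symm ⟨0, 0, 1, 0⟩ + (e h).imK • e.symm ⟨0, 0, 0, 1⟩ := by
        apply e.injective
        ext <;> simp
      conv_rhs => rw [hh]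
      have hmul : ∀ t : F, r * algebraMap F R t = t • r := fun t => by
        rw [mul_comm, Algebra.smul_def]
      rw [hΨ]
      simp only [κ, QuaternionAlgebra.re_smul, QuaternionAlgebra.imI_smul,
        QuaternionAlgebra.imJ_smul, QuaternionAlgebra.imK_smul, smul_eq_mul, hmul,
        TensorProduct.tmul_smul, TensorProduct.add_tmul, TensorProduct.smul_tmul']
  have hΨκ : ∀ x, Ψ (κ x) = x := by
    intro x
    simp only [κ, map_add, hΨ, AlgEquiv.apply_symm_apply]
    ext <;> simp
  refine ⟨RingEquiv.ofBijective Ψ.toRingHom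
    ⟨Function.LeftInverse.injective hκΨ, Function.RightInverse.surjective hΨκ⟩, fun x => ?_⟩
  change Ψ (QuaternionConj.extend F H R x) = star (Ψ x)
  induction x using TensorProduct.induction_on with
  | zero => simp
  | add x y hx hy => rw [map_add, map_add, map_add, star_add, hx, hy]
  | tmul h r =>
    rw [QuaternionConj.extend, TensorProduct.map_tmul, LinearMap.id_apply, hΨ, hΨ,
      QuaternionConj.algEquiv_conj e]
    ext <;> simp
    ring

end BaseChange

/-! ### Quaternions over the adeles -/

namespace Place

variable {F : Type*} [Field F]

/-- The ring of integers of the completion at a finite place. -/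
def integers {v : Place F} (hv : v.IsFinite) : ValuationSubring v.Completion where
  carrier := {x | ‖x‖ ≤ 1}
  mul_mem' {x y} hx hy := by
    rw [Set.mem_ofPred_eq, norm_mul]
    exact mul_le_one₀ hx (norm_nonneg _) hy
  one_mem' := by simp
  add_mem' {x y} hx hy := (norm_add_le_max hv x y).trans (max_le hx hy)
  zero_mem' := by simp
  neg_mem' {x} hx := by simpa using hx
  mem_or_inv_mem' x := by
    simp only [Set.mem_ofPred_eq, norm_inv]
    rcases le_total ‖x‖ 1 with h | h
    · exact Or.inl h
    · exact Or.inr (inv_le_one_of_one_le₀ h)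

variable (F) in
/-- Matrices of quaternions over the completion at `v`. -/
abbrev LocalQuaternionMatrix (a b c : F) (ι : Type*) (v : Place F) : Type _ := Matrix ι ι (Over v.Completion a b c)

variable {a b c : F} {ι : Type*}

/-- All coordinates of all entries are integral. -/
def IsIntegralAt {v : Place F} (X : LocalQuaternionMatrix F a b c ι v) : Prop :=
  ∀ i j, ‖(X i j).re‖ ≤ 1 ∧ ‖(X i j).imI‖ ≤ 1 ∧ ‖(X i j).imJ‖ ≤ 1 ∧ ‖(X i j).imK‖ ≤ 1

variable [Fintype ι] [DecidableEq ι]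

/-- The symmetric stable range condition over the completion at `v`, with integral solutions for
integral data. -/
theorem exists_local_isUnit_add_mul (h2 : (2 : F) = 0) (hb : b ≠ 0) (hc : c ≠ 0) (v : Place F)
    {A C X Y : LocalQuaternionMatrix F a b c ι v} (hAC : star A * C = star C * A)
    (hXY : X * A + Y * C = 1) :
    ∃ s U : LocalQuaternionMatrix F a b c ι v, star s = s ∧ (A + s * C) * U = 1 ∧
      U * (A + s * C) = 1 ∧ (v.IsFinite → IsIntegralAt A → IsIntegralAt C → IsIntegralAt X →
        IsIntegralAt Y → (∀ x ∈ ({a, b, c, b⁻¹, c⁻¹} : Set F), ‖algebraMap F v.Completion x‖ ≤ 1) →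
          IsIntegralAt s ∧ IsIntegralAt U) := by
  by_cases hgood : v.IsFinite ∧ IsIntegralAt A ∧ IsIntegralAt C ∧ IsIntegralAt X ∧
      IsIntegralAt Y ∧ (∀ x ∈ ({a, b, c, b⁻¹, c⁻¹} : Set F), ‖algebraMap F v.Completion x‖ ≤ 1)
  · obtain ⟨hv, hA, hC, hX, hY, hx⟩ := hgood
    let O := integers hv
    have hx' : ∀ x ∈ ({a, b, c, b⁻¹, c⁻¹} : Set F), algebraMap F v.Completion x ∈ O := hx
    let a' : O := ⟨_, hx' a (by simp)⟩
    let b' : O := ⟨_, hx' b (by simp)⟩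
    let c' : O := ⟨_, hx' c (by simp)⟩
    have hunit : ∀ x : F, x ≠ 0 → ∀ (h : algebraMap F v.Completion x ∈ O)
        (_ : algebraMap F v.Completion x⁻¹ ∈ O), IsUnit (⟨_, h⟩ : O) := fun x hx0 h h' =>
      IsUnit.of_mul_eq_one ⟨_, h'⟩ (Subtype.ext (by
        change algebraMap F v.Completion x * algebraMap F v.Completion x⁻¹ = 1
        rw [← map_mul, mul_inv_cancel₀ hx0, map_one]))
    let φ : ℍ[O,a',b',c'] →+* Over v.Completion a b c :=
      QuaternionAlgebra.mapHom O.subtype rfl rfl rfl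
    have hφi : Function.Injective (φ.mapMatrix (m := ι)) := by
      have hφ : Function.Injective φ := fun x y hxy => by
        rw [QuaternionAlgebra.ext_iff] at hxy
        exact QuaternionAlgebra.ext (Subtype.ext hxy.1) (Subtype.ext hxy.2.1)
          (Subtype.ext hxy.2.2.1) (Subtype.ext hxy.2.2.2)
      exact fun X Y hXY => Matrix.ext fun i j => hφ (congrFun (congrFun hXY i) j)
    have hφs : ∀ Z, φ.mapMatrix (star Z) = star (φ.mapMatrix (m := ι) Z) :=
      Matrix.mapMatrix_star _ (QuaternionAlgebra.mapHom_star _ _ _ _)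
    have hlift : ∀ Z : LocalQuaternionMatrix F a b c ι v, IsIntegralAt Z →
        ∃ Z', φ.mapMatrix Z' = Z := fun Z hZ =>
      ⟨Matrix.of fun i j => ⟨⟨_, (hZ i j).1⟩, ⟨_, (hZ i j).2.1⟩, ⟨_, (hZ i j).2.2.1⟩,
        ⟨_, (hZ i j).2.2.2⟩⟩, rfl⟩
    have hint : ∀ Z, IsIntegralAt (φ.mapMatrix Z : LocalQuaternionMatrix F a b c ι v) :=
      fun Z i j => ⟨(Z i j).re.2, (Z i j).imI.2, (Z i j).imJ.2, (Z i j).imK.2⟩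
    obtain ⟨A, rfl⟩ := hlift A hA
    obtain ⟨C, rfl⟩ := hlift C hC
    obtain ⟨X, rfl⟩ := hlift X hX
    obtain ⟨Y, rfl⟩ := hlift Y hY
    rw [← hφs, ← hφs, ← map_mul, ← map_mul] at hAC
    rw [← map_mul, ← map_mul, ← map_add, ← map_one φ.mapMatrix] at hXY
    obtain ⟨s, hs, u, hu⟩ := exists_isUnit_add_mul_of_isLocalRing (O := O)
      (Subtype.ext (by
        change (2 : v.Completion) = 0
        rw [← map_ofNat (algebraMap F v.Completion) 2, h2, map_zero]))
      (hunit b hb _ (hx' _ (by simp))) (hunit c hc _ (hx' _ (by simp))) (hφi hAC) (hφi hXY)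
    refine ⟨φ.mapMatrix s, φ.mapMatrix (u⁻¹).1, ?_, ?_, ?_, fun _ _ _ _ _ _ => ⟨hint _, hint _⟩⟩
    · rw [← hφs, hs]
    · rw [← map_mul, ← map_add, ← hu, ← map_mul, Units.mul_inv, map_one]
    · rw [← map_mul, ← map_add, ← hu, ← map_mul, Units.inv_mul, map_one]
  · obtain ⟨s, hs, u, hu⟩ := exists_isUnit_add_mul_of_isLocalRing
      (by rw [← map_ofNat (algebraMap F v.Completion) 2, h2, map_zero])
      (IsUnit.mk0 _ (by simpa using hb)) (IsUnit.mk0 _ (by simpa using hc)) hAC hXY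
    refine ⟨s, (u⁻¹).1, hs, ?_, ?_, fun h1 h2 h3 h4 h5 h6 =>
      absurd ⟨h1, h2, h3, h4, h5, h6⟩ hgood⟩
    · rw [← hu, Units.mul_inv]
    · rw [← hu, Units.inv_mul]

end Place

namespace AdeleRing

open Place

variable (F : Type*) [Field F] [IsGlobalField F] (a b c : F) (ι : Type*)

/-- Matrices of adelic quaternions in coordinates. -/
abbrev QuaternionMatrix : Type _ := Matrix ι ι (Over (AdeleRing F) a b c)

variable {F} in
/-- The projection from the adele ring to the completion at `v`. -/
noncomputable def eval (v : Place F) : AdeleRing F →+* v.Completion :=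
  (Pi.evalRingHom _ v).comp (adeles F).val.toRingHom

/-- The local component of a quaternion with adelic coordinates. -/
noncomputable def quaternionEval (v : Place F) :
    Over (AdeleRing F) a b c →+* Over v.Completion a b c :=
  QuaternionAlgebra.mapHom (eval v) rfl rfl rfl

variable {F a b c ι}

variable [Fintype ι] [DecidableEq ι]

theorem ext_quaternionEval {X Y : QuaternionMatrix F a b c ι}
    (h : ∀ v, (quaternionEval F a b c v).mapMatrix X = (quaternionEval F a b c v).mapMatrix Y) :
    X = Y := by
  have key : ∀ i j v, quaternionEval F a b c v (X i j) = quaternionEval F a b c v (Y i j) :=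
    fun i j v => congrFun (congrFun (h v) i) j
  ext i j v
  exacts [congrArg QuaternionAlgebra.re (key i j v), congrArg QuaternionAlgebra.imI (key i j v),
    congrArg QuaternionAlgebra.imJ (key i j v), congrArg QuaternionAlgebra.imK (key i j v)]

/-- A family of local matrices that are integral at almost all finite places comes from a matrix
of adelic quaternions. -/
theorem exists_quaternionEval_eq (f : ∀ v, LocalQuaternionMatrix F a b c ι v)
    (hf : {v : Place F | v.IsFinite ∧ ¬ IsIntegralAt (f v)}.Finite) :
    ∃ X : QuaternionMatrix F a b c ι, ∀ v, (quaternionEval F a b c v).mapMatrix X = f v := by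
  have h : ∀ g : ∀ v : Place F, v.Completion, (∀ v, IsIntegralAt (f v) → ‖g v‖ ≤ 1) →
      g ∈ adeles F := fun g hg =>
    hf.subset fun v hv => ⟨hv.1, fun hi => absurd (hg v hi) (not_le.2 hv.2)⟩
  refine ⟨Matrix.of fun i j =>
    ⟨⟨fun v => (f v i j).re, h _ fun v hv => (hv i j).1⟩,
      ⟨fun v => (f v i j).imI, h _ fun v hv => (hv i j).2.1⟩,
      ⟨fun v => (f v i j).imJ, h _ fun v hv => (hv i j).2.2.1⟩,
      ⟨fun v => (f v i j).imK, h _ fun v hv => (hv i j).2.2.2⟩⟩, fun v => ?_⟩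
  rfl

theorem finite_not_isIntegralAt (X : QuaternionMatrix F a b c ι) :
    {v : Place F | v.IsFinite ∧
      ¬ IsIntegralAt ((quaternionEval F a b c v).mapMatrix X)}.Finite := by
  have key : ∀ x : AdeleRing F, {v : Place F | v.IsFinite ∧ 1 < ‖eval v x‖}.Finite := fun x => x.2
  refine Set.Finite.subset (Set.finite_iUnion fun i => Set.finite_iUnion fun j =>
    (key (X i j).re).union ((key (X i j).imI).union ((key (X i j).imJ).union
      (key (X i j).imK)))) ?_
  rintro v ⟨hv, hi⟩
  simp only [Set.mem_iUnion, Set.mem_union, Set.mem_ofPred_eq, hv, true_and]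
  by_contra! hcon
  exact hi fun i j => hcon i j

theorem finite_isFinite_and_one_lt_norm (x : F) :
    {v : Place F | v.IsFinite ∧ 1 < ‖algebraMap F v.Completion x‖}.Finite := by
  simpa only [Place.norm_algebraMap] using Place.finite_poles x

/-- In characteristic two, matrix rings over adelic quaternions have symmetric stable range one. -/
theorem exists_isUnit_add_mul (h2 : (2 : F) = 0) (hb : b ≠ 0) (hc : c ≠ 0)
    {A C X Y : QuaternionMatrix F a b c ι} (hAC : star A * C = star C * A)
    (hXY : X * A + Y * C = 1) : ∃ s, star s = s ∧ IsUnit (A + s * C) := by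
  let ev v := (quaternionEval F a b c v).mapMatrix (m := ι)
  have hevs : ∀ v Z, ev v (star Z) = star (ev v Z) := fun v =>
    Matrix.mapMatrix_star _ (QuaternionAlgebra.mapHom_star _ _ _ _)
  choose s U hs hU hU' hint using fun v => exists_local_isUnit_add_mul h2 hb hc v
    (A := ev v A) (C := ev v C) (X := ev v X) (Y := ev v Y)
    (by rw [← hevs, ← hevs, ← map_mul, ← map_mul, hAC])
    (by rw [← map_mul, ← map_mul, ← map_add, hXY, map_one])
  have hfin : {v : Place F | v.IsFinite ∧ ¬ (IsIntegralAt (s v) ∧ IsIntegralAt (U v))}.Finite := by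
    refine ((((finite_not_isIntegralAt A).union (finite_not_isIntegralAt C)).union
      ((finite_not_isIntegralAt X).union (finite_not_isIntegralAt Y))).union
      ((Set.toFinite ({a, b, c, b⁻¹, c⁻¹} : Set F)).biUnion fun x _ =>
        finite_isFinite_and_one_lt_norm x)).subset ?_
    rintro v ⟨hv, hn⟩
    by_contra hcon
    simp only [Set.mem_union, Set.mem_iUnion, Set.mem_ofPred_eq, hv, true_and, not_or, not_not,
      not_exists, not_lt] at hcon
    exact hn (hint v hv hcon.1.1.1 hcon.1.1.2 hcon.1.2.1 hcon.1.2.2 hcon.2)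
  obtain ⟨s', hs'⟩ := exists_quaternionEval_eq s
    (hfin.subset fun v hv => ⟨hv.1, fun h => hv.2 h.1⟩)
  obtain ⟨U', hU'eq⟩ := exists_quaternionEval_eq U
    (hfin.subset fun v hv => ⟨hv.1, fun h => hv.2 h.2⟩)
  refine ⟨s', ext_quaternionEval fun v => ?_, ⟨⟨A + s' * C, U', ext_quaternionEval fun v => ?_,
    ext_quaternionEval fun v => ?_⟩, rfl⟩⟩
  · rw [hevs, hs', hs]
  · rw [map_mul, map_add, map_mul, hs', hU'eq, map_one]; exact hU v
  · rw [map_mul, map_add, map_mul, hs', hU'eq, map_one]; exact hU' v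

end AdeleRing

/-! ### Places at which a given element is a square -/

namespace GlobalField

open Polynomial in
/-- If `E` is a nonzero element of a finite extension of the fraction field of `R`, and `R` has
finitely many units, then the norm of `1 - s ^ k * E` cannot be a unit of `R` for every `s : R`,
being a nonconstant polynomial in `s`. -/
theorem exists_not_isUnit_one_sub_pow_mul (R K : Type*) {L : Type*} [CommRing R] [IsDomain R]
    [IsIntegrallyClosed R] [Infinite R] [Finite Rˣ] [Field K] [Algebra R K]
    [IsFractionRing R K] [Field L] [Algebra K L] [FiniteDimensional K L] [Algebra R L]
    [IsScalarTower R K L] {E : integralClosure R L} (hE : E ≠ 0) {k : ℕ} (hk : 0 < k) :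
    ∃ s : R, ¬ IsUnit (1 - algebraMap R (integralClosure R L) s ^ k * E) := by
  by_contra! hcon
  let bas := Module.finBasis K L
  set M := Algebra.leftMulMatrix bas (E : L) with hM
  have heval : ∀ s : R, (expand K k M.charpolyRev).eval (algebraMap R K s) =
      Algebra.norm K ((1 - algebraMap R (integralClosure R L) s ^ k * E :
        integralClosure R L) : L) := by
    intro s
    have h1 : ((1 - algebraMap R (integralClosure R L) s ^ k * E : integralClosure R L) : L) =
        1 - (algebraMap R K s ^ k) • (E : L) := by
      rw [Algebra.smul_def, map_pow, ← IsScalarTower.algebraMap_apply]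
      rfl
    rw [h1, Algebra.norm_eq_matrix_det bas, map_sub, map_one, map_smul, ← hM, expand_eval,
      Matrix.charpolyRev, ← coe_evalRingHom, RingHom.map_det]
    congr 1
    ext i j
    simp [Matrix.one_apply, apply_ite]
    exact mul_comm _ _
  have hint : ∀ x : integralClosure R L, ∃ r : R, algebraMap R K r = Algebra.norm K (x : L) :=
    fun x => IsIntegrallyClosed.isIntegral_iff.1 (Algebra.isIntegral_norm K x.2)
  have hunit : ∀ s : R, ∃ u : Rˣ, algebraMap R K u = Algebra.norm K
      ((1 - algebraMap R (integralClosure R L) s ^ k * E : integralClosure R L) : L) := by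
    intro s
    obtain ⟨z, hz⟩ := hcon s
    obtain ⟨r, hr⟩ := hint z.1
    obtain ⟨r', hr'⟩ := hint (z⁻¹).1
    have hrr : r * r' = 1 := IsFractionRing.injective R K (by
      have hz1 : (z.1 : L) * ((z⁻¹).1 : L) = 1 := congrArg Subtype.val z.mul_inv
      rw [map_mul, hr, hr', ← map_mul, hz1, map_one, map_one])
    exact ⟨Units.mkOfMulEqOne r r' hrr, by rw [← hz, ← hr]; rfl⟩
  choose u hu using hunit
  obtain ⟨u₀, hu₀⟩ := Finite.exists_infinite_fiber u
  have hconst : expand K k M.charpolyRev = C (algebraMap R K u₀) := by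
    rw [← sub_eq_zero]
    refine eq_zero_of_infinite_isRoot _ (Set.Infinite.mono ?_
      ((Set.infinite_coe_iff.1 hu₀).image (IsFractionRing.injective R K).injOn))
    rintro _ ⟨s, hs, rfl⟩
    have hs : u s = u₀ := hs
    rw [Set.mem_ofPred_eq, IsRoot, eval_sub, eval_C, heval, ← hu, hs, sub_self]
  have hdeg := congrArg natDegree hconst
  rw [natDegree_expand, natDegree_C, ← Matrix.reverse_charpoly, reverse_natDegree,
    Matrix.charpoly_natDegree_eq_dim, Fintype.card_fin, natTrailingDegree_eq_zero.2, tsub_zero]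
    at hdeg
  · exact (Nat.mul_pos Module.finrank_pos hk).ne' hdeg
  · right
    have hdet : M.det ≠ 0 := by
      rw [hM, ← Algebra.norm_eq_matrix_det, Algebra.norm_ne_zero_iff]
      simpa using hE
    rw [Matrix.det_eq_sign_charpoly_coeff] at hdet
    exact right_ne_zero_of_mul hdet

/-- Some element `E * x ^ (2 * q)` is close to `1` for a nonarchimedean absolute value. With `m` a
denominator of `E` and a suitable `s` in `R`, the element `1 - (4 * m * s) ^ (2 * q) * E` is a
nonunit of the integral closure of `R`; a prime containing it does not contain `2`, and its adic
absolute value is the required one. -/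
theorem exists_abv_mul_pow_sub_one_lt (R K : Type*) {L : Type*} [CommRing R] [IsDedekindDomain R]
    [Finite Rˣ] (hR : ¬ IsField R) [Field K] [Algebra R K] [IsFractionRing R K] [Field L]
    [Algebra K L] [FiniteDimensional K L] [Algebra.IsSeparable K L] (h2 : (2 : L) ≠ 0) {E : L}
    (hE : E ≠ 0) {q : ℕ} (hq : 0 < q) :
    ∃ w : AbsoluteValue L ℝ, w.IsNontrivial ∧ IsNonarchimedean w ∧
      ∃ x : K, x ≠ 0 ∧ w (E * algebraMap K L x ^ (2 * q) - 1) < w 4 := by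
  have : Infinite R := by
    by_contra hfin
    rw [not_infinite_iff_finite] at hfin
    exact hR (Finite.isField_of_domain R)
  let : Algebra R L := ((algebraMap K L).comp (algebraMap R K)).toAlgebra
  have : IsScalarTower R K L := IsScalarTower.of_algebraMap_eq fun _ => rfl
  let O := integralClosure R L
  have : IsFractionRing O L := integralClosure.isFractionRing_of_finite_extension K L
  have : IsDedekindDomain O := integralClosure.isDedekindDomain R K L
  have hRL : Function.Injective (algebraMap R L) := by
    exact (algebraMap K L).injective.comp (IsFractionRing.injective R K)
  have hO : ¬ IsField O := fun h => hR (by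
    exact isField_of_isIntegral_of_isField (R := R) (S := O)
      (fun x y hxy => hRL (congrArg Subtype.val hxy)) h)
  have halg : IsAlgebraic R E := by
    exact (IsFractionRing.isAlgebraic_iff R K L).2 (Algebra.IsAlgebraic.isAlgebraic E)
  obtain ⟨m, hm0, hm⟩ := halg.exists_integral_multiple
  let f : R →+* O := algebraMap R O
  have hf : ∀ r, ((f r : O) : L) = algebraMap R L r := fun _ => rfl
  let E' : O := f (4 * m) ^ (2 * q - 1) * 4 * ⟨m • E, hm⟩
  have hE' : (E' : L) = algebraMap R L (4 * m) ^ (2 * q) * E := by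
    change algebraMap R L (4 * m) ^ (2 * q - 1) * 4 * (m • E) = _
    rw [Algebra.smul_def, ← pow_sub_one_mul (by omega : 2 * q ≠ 0), map_mul, map_ofNat]
    ring
  have h4 : (4 : L) ≠ 0 := by
    rw [show (4 : L) = 2 * 2 by norm_num]; exact mul_ne_zero h2 h2
  have h4m : algebraMap R L (4 * m) ≠ 0 := by
    rw [map_mul, map_ofNat]
    exact mul_ne_zero h4 ((map_ne_zero_iff _ hRL).2 hm0)
  have hE'0 : E' ≠ 0 := fun h0 =>
    mul_ne_zero (pow_ne_zero (2 * q) h4m) hE (by rw [← hE', h0]; rfl)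
  obtain ⟨s, hs⟩ := exists_not_isUnit_one_sub_pow_mul R K hE'0 (k := 2 * q) (by omega)
  have hs0 : s ≠ 0 := by
    rintro rfl
    apply hs
    rw [map_zero, zero_pow (by omega), zero_mul, sub_zero]
    exact isUnit_one
  obtain ⟨P, hP, hz⟩ := exists_max_ideal_of_mem_nonunits hs
  let v : IsDedekindDomain.HeightOneSpectrum O :=
    ⟨P, hP.isPrime, Ring.ne_bot_of_isMaximal_of_not_isField hP hO⟩
  let w : AbsoluteValue L ℝ := v.adicAbv (K := L) (b := 2) one_lt_two
  have hw2 : w 2 = 1 := by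
    have h2P : (2 : O) ∉ v.asIdeal := fun h2P => hP.ne_top (by
      rw [Ideal.eq_top_iff_one, ← sub_add_cancel 1 (f s ^ (2 * q) * E')]
      refine Ideal.add_mem _ hz (Ideal.mul_mem_left _ _ ?_)
      have : E' = f (4 * m) ^ (2 * q - 1) * 2 * ⟨m • E, hm⟩ * 2 := by simp only [E']; ring
      rw [this]
      exact Ideal.mul_mem_left _ _ h2P)
    exact (v.adicAbv_coe_eq_one_iff (K := L) one_lt_two 2).2 h2P
  have hw4 : w 4 = 1 := by
    rw [show (4 : L) = 2 * 2 by norm_num, map_mul, hw2, one_mul]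
  have hwz : w (E * algebraMap K L (algebraMap R K (4 * m * s)) ^ (2 * q) - 1) < 1 := by
    have h1 := (v.adicAbv_coe_lt_one_iff (K := L) one_lt_two _).2 hz
    convert h1 using 1
    change w _ = w ((1 - f s ^ (2 * q) * E' : O) : L)
    rw [← AbsoluteValue.map_neg, ← IsScalarTower.algebraMap_apply, map_mul (algebraMap R L)]
    congr 1
    change _ = 1 - algebraMap R L s ^ (2 * q) * (E' : L)
    rw [hE']
    ring
  refine ⟨w, ?_, v.isNonarchimedean_adicAbv one_lt_two, algebraMap R K (4 * m * s), ?_,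
    hwz.trans_eq hw4.symm⟩
  · obtain ⟨y, hy, hy0⟩ := Submodule.exists_mem_ne_zero_of_ne_bot v.ne_bot
    exact ⟨(y : L), by simpa using hy0, ((v.adicAbv_coe_lt_one_iff (K := L) one_lt_two y).2 hy).ne⟩
  · intro h0
    have h1 : algebraMap R L (4 * m * s) = 0 := by
      rw [IsScalarTower.algebraMap_apply R K L, h0, map_zero]
    rw [map_mul] at h1
    exact mul_ne_zero h4m ((map_ne_zero_iff _ hRL).2 hs0) h1

/-- Every nonzero `D` in a global field is a square up to an error of absolute value less than `|4|`,
for some nonarchimedean absolute value. An inseparable function field is embedded by a power of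
Frobenius into the separable closure of `𝔽_p(t)` in it, where separability ensures that the integral
closure of `𝔽_p[t]` is a Dedekind domain; this is why `exists_abv_mul_pow_sub_one_lt` allows an
exponent `2 * q`. -/
theorem exists_abv_mul_sq_sub_one_lt (F : Type*) [Field F] [IsGlobalField F] (h2 : (2 : F) ≠ 0)
    {D : F} (hD : D ≠ 0) : ∃ w : AbsoluteValue F ℝ, w.IsNontrivial ∧ IsNonarchimedean w ∧
      ∃ x : F, x ≠ 0 ∧ w (D * x ^ 2 - 1) < w 4 := by
  rcases IsGlobalField.numberField_or_functionField (F := F) with h | ⟨p, _, _, _⟩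
  · obtain ⟨w, hw, hn, x, hx, hlt⟩ := exists_abv_mul_pow_sub_one_lt ℤ ℚ Int.not_isField h2 hD
      one_pos
    exact ⟨w, hw, hn, algebraMap ℚ F x, by simpa using hx, by simpa using hlt⟩
  · let K := RatFunc (ZMod p)
    let L := separableClosure K F
    have : CharP K p := charP_of_injective_algebraMap (algebraMap (ZMod p) K).injective p
    have : CharP L p := charP_of_injective_algebraMap (algebraMap K L).injective p
    have : ExpChar L p := ExpChar.prime Fact.out
    let n := IsPurelyInseparable.exponent L F
    let φ : F →+* L := IsPurelyInseparable.iterateFrobenius L F p (n := n) le_rfl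
    have hφ : ∀ x : K, φ (algebraMap K F x) = algebraMap K L x ^ p ^ n := fun x => by
      rw [IsScalarTower.algebraMap_apply K L F]
      exact IsPurelyInseparable.iterateFrobenius_algebraMap F p le_rfl _
    have : Finite (Polynomial (ZMod p))ˣ := by
      refine Finite.of_surjective (Units.map (Polynomial.C (R := ZMod p)).toMonoidHom) fun u => ?_
      obtain ⟨r, hr, hru⟩ := Polynomial.isUnit_iff.1 u.isUnit
      obtain ⟨r, rfl⟩ := hr
      exact ⟨r, Units.ext hru⟩
    have h2' : (2 : L) ≠ 0 := by
      rw [← map_ofNat φ 2, map_ne_zero_iff _ φ.injective]; exact h2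
    obtain ⟨w, hw, hn, x, hx, hlt⟩ := exists_abv_mul_pow_sub_one_lt (Polynomial (ZMod p)) K
      (Polynomial.not_isField _) h2' ((map_ne_zero_iff _ φ.injective).2 hD)
      (pow_pos (Nat.Prime.pos (Fact.out : p.Prime)) n)
    refine ⟨w.comp φ.injective, ?_, fun x y => ?_, algebraMap K F x, ?_, ?_⟩
    · obtain ⟨y, hy, hy1⟩ := hw
      refine ⟨algebraMap L F y, by simpa using hy, fun h1 => ?_⟩
      change w (φ (algebraMap L F y)) = 1 at h1
      rw [IsPurelyInseparable.iterateFrobenius_algebraMap F p le_rfl, map_pow] at h1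
      exact hy1 ((pow_eq_one_iff_of_nonneg (w.nonneg _)
        (pow_pos (Nat.Prime.pos (Fact.out : p.Prime)) n).ne').1 h1)
    · have := hn (φ x) (φ y)
      rw [← map_add] at this
      exact this
    · simpa using hx
    · change w (φ (D * algebraMap K F x ^ 2 - 1)) < w (φ 4)
      rw [map_sub, map_mul, map_pow, map_one, map_ofNat, hφ, ← pow_mul, mul_comm (p ^ n)]
      exact hlt

end GlobalField

namespace Place

variable {F : Type*} [Field F]

/-- Hensel's lemma for `1 + 4 u`, whose square root is `1 + 2 y` with `y + y ^ 2 = u`. -/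
theorem exists_add_sq_eq {v : Place F} (hv : v.IsFinite) {u : v.Completion} (hu : ‖u‖ < 1) :
    ∃ y, y + y ^ 2 = u := by
  let s : Set v.Completion := Metric.closedBall 0 ‖u‖
  have hs : ∀ x, x ∈ s ↔ ‖x‖ ≤ ‖u‖ := fun x => by simp [s]
  have hmaps : Set.MapsTo (fun y => u - y ^ 2) s s := by
    intro y hy
    rw [hs] at hy ⊢
    change ‖u - y ^ 2‖ ≤ ‖u‖
    rw [sub_eq_add_neg]
    refine (norm_add_le_max hv _ _).trans (max_le le_rfl ?_)
    rw [norm_neg, norm_pow, sq]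
    exact (mul_le_of_le_one_left (norm_nonneg _) (hy.trans hu.le)).trans hy
  have hc : ContractingWith ‖u‖₊ (hmaps.restrict (fun y => u - y ^ 2) s s) := by
    refine ⟨hu, LipschitzWith.of_dist_le_mul fun y z => ?_⟩
    have hy := (hs _).1 y.2
    have hz := (hs _).1 z.2
    rw [Subtype.dist_eq, Subtype.dist_eq, dist_eq_norm, dist_eq_norm]
    change ‖(u - y.1 ^ 2) - (u - z.1 ^ 2)‖ ≤ ‖u‖ * ‖y.1 - z.1‖
    rw [show (u - y.1 ^ 2) - (u - z.1 ^ 2) = -((y.1 + z.1) * (y.1 - z.1)) by ring, norm_neg,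
      norm_mul]
    exact mul_le_mul_of_nonneg_right ((norm_add_le_max hv _ _).trans (max_le hy hz))
      (norm_nonneg _)
  obtain ⟨y, -, hy, -⟩ := hc.exists_fixedPoint' Metric.isClosed_closedBall.isComplete hmaps
    ((hs 0).2 (by simp)) (edist_ne_top _ _)
  exact ⟨y, by linear_combination -hy.eq⟩

/-- Every nonzero element of a global field of characteristic different from two is a square at
some place. -/
theorem exists_sq_eq [IsGlobalField F] (h2 : (2 : F) ≠ 0) {D : F} (hD : D ≠ 0) :
    ∃ v : Place F, ∃ d : v.Completion, d ^ 2 = algebraMap F v.Completion D := by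
  obtain ⟨w, hw, hn, x, hx, hlt⟩ := GlobalField.exists_abv_mul_sq_sub_one_lt F h2 hD
  let v : Place F := Quotient.mk _ ⟨w, hw⟩
  have hvw : v.abv.IsEquiv w := Quotient.exact (Quotient.out_eq v)
  have hv : v.IsFinite := fun y z => by
    have := hn y z
    rw [le_max_iff] at this ⊢
    rwa [hvw.le_iff_le, hvw.le_iff_le]
  rw [← hvw.lt_iff_lt] at hlt
  have h4 : (4 : F) ≠ 0 := by
    rw [show (4 : F) = 2 * 2 by norm_num]; exact mul_ne_zero h2 h2
  obtain ⟨y, hy⟩ := exists_add_sq_eq hv (u := algebraMap F _ ((D * x ^ 2 - 1) / 4)) (by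
    rw [norm_algebraMap, map_div₀, div_lt_one (v.abv.pos h4)]
    exact hlt)
  refine ⟨v, (1 + 2 * y) / algebraMap F _ x, ?_⟩
  have hx' : algebraMap F v.Completion x ≠ 0 := by simpa using hx
  rw [div_pow, div_eq_iff (pow_ne_zero 2 hx'), show (1 + 2 * y) ^ 2 = 1 + 4 * (y + y ^ 2) by ring,
    hy, ← map_ofNat (algebraMap F v.Completion) 4, ← map_mul, mul_div_cancel₀ _ h4, map_sub,
    map_one, map_mul, map_pow, add_sub_cancel]

end Place

/-! ### The obstruction from a split place -/

namespace SLStar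

/-- A `2 × 2` matrix representation turning the involution into the adjugate induces a
representation of the matrix ring under which the involution preserves determinants. -/
theorem det_compRingEquiv_mapMatrix_star {Q K ι : Type*} [Ring Q] [StarRing Q] [CommRing K]
    [Fintype ι] [DecidableEq ι] (χ : Q →+* Matrix (Fin 2) (Fin 2) K)
    (hχ : ∀ x, χ (star x) = (χ x).adjugate) (X : Matrix ι ι Q) :
    (Matrix.compRingEquiv ι (Fin 2) K (χ.mapMatrix (star X))).det =
      (Matrix.compRingEquiv ι (Fin 2) K (χ.mapMatrix X)).det := by
  let D : Matrix ι ι (Matrix (Fin 2) (Fin 2) K) := Matrix.diagonal fun _ => !![0, 1; -1, 0]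
  let D' : Matrix ι ι (Matrix (Fin 2) (Fin 2) K) := Matrix.diagonal fun _ => !![0, -1; 1, 0]
  have hD : D * D' = 1 := by
    rw [Matrix.diagonal_mul_diagonal]
    simp [Matrix.one_fin_two.symm]
  have key : χ.mapMatrix (star X) = D * ((χ.mapMatrix X).map Matrix.transpose).transpose * D' := by
    ext i j p q
    rw [Matrix.mul_diagonal, Matrix.diagonal_mul]
    simp only [RingHom.mapMatrix_apply, Matrix.map_apply, Matrix.star_apply, hχ,
      Matrix.adjugate_fin_two, Matrix.transpose_apply]
    fin_cases p <;> fin_cases q <;>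
      simp [Matrix.mul_apply, Fin.sum_univ_two, Matrix.vecMul_transpose]
  have hdet : (Matrix.compRingEquiv ι (Fin 2) K D).det *
      (Matrix.compRingEquiv ι (Fin 2) K D').det = 1 := by
    rw [← Matrix.det_mul, ← map_mul, hD, map_one, Matrix.det_one]
  have htr : Matrix.compRingEquiv ι (Fin 2) K ((χ.mapMatrix X).map Matrix.transpose).transpose =
      (Matrix.compRingEquiv ι (Fin 2) K (χ.mapMatrix X)).transpose := rfl
  rw [key, map_mul, map_mul, Matrix.det_mul, Matrix.det_mul, htr, Matrix.det_transpose]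
  linear_combination (Matrix.compRingEquiv ι (Fin 2) K (χ.mapMatrix X)).det * hdet

/-- If `Q` has a component that is a split quaternion algebra in which `-1 ≠ 1`, then a reflection
in that component is not generated by Bruhat elements. -/
theorem closure_bruhatElements_ne_top {Q K ι : Type*} [Ring Q] [StarRing Q] [CommRing K]
    [Fintype ι] [DecidableEq ι] [Nonempty ι] (hK : (-1 : K) ≠ 1)
    (χ : Q →+* Matrix (Fin 2) (Fin 2) K) (hχ : ∀ x, χ (star x) = (χ x).adjugate)
    {e₁₁ e₁₂ e₂₁ e₂₂ : Q} (he : AdjugateUnits e₁₁ e₁₂ e₂₁ e₂₂)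
    (h11 : χ e₁₁ = Matrix.single 0 0 1) (h12 : χ e₁₂ = Matrix.single 0 1 1)
    (h21 : χ e₂₁ = Matrix.single 1 0 1) (h22 : χ e₂₂ = Matrix.single 1 1 1) :
    Subgroup.closure (bruhatElements (Matrix ι ι Q)) ≠ ⊤ := by
  intro htop
  let i : ι := Classical.arbitrary ι
  let φ : Q →ₙ+* Matrix ι ι Q :=
    { toFun := Matrix.single i i
      map_zero' := Matrix.single_zero _ _
      map_add' := Matrix.single_add _ _
      map_mul' := fun x y => (Matrix.single_mul_single_same _ i i i y).symm }
  have hφ : ∀ x, φ (star x) = star (φ x) := fun x => (Matrix.conjTranspose_single i i x).symm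
  let θ : Matrix ι ι Q →+* Matrix (ι × Fin 2) (ι × Fin 2) K :=
    (Matrix.compRingEquiv ι (Fin 2) K).toRingHom.comp χ.mapMatrix
  have hθ : ∀ x p q, χ x = Matrix.single p q 1 → θ (φ x) = Matrix.single (i, p) (i, q) 1 := by
    intro x p q hx
    change Matrix.comp ι ι (Fin 2) (Fin 2) K ((Matrix.single i i x).map χ) = _
    rw [Matrix.map_single, hx]
    ext ⟨k, r⟩ ⟨l, s⟩
    by_cases hkl : i = k ∧ i = l
    · simp [Matrix.comp_apply, Matrix.single_apply, Prod.mk.injEq, hkl.1.symm, hkl.2.symm]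
    · rw [Matrix.comp_apply, Matrix.single_apply, if_neg hkl, Matrix.single_apply, if_neg]
      · rfl
      · simp only [Prod.mk.injEq]
        tauto
  have h1 := blockDet_eq_one θ (det_compRingEquiv_mapMatrix_star χ hχ)
    (htop ▸ Subgroup.mem_top (reflection (he.map φ hφ)))
  have h2 := blockDet_reflection θ (he.map φ hφ) (i, 0) (i, 1) (hθ _ _ _ h11) (hθ _ _ _ h12)
    (hθ _ _ _ h21) (hθ _ _ _ h22)
  exact hK (h2.symm.trans h1)

end SLStar

namespace QuaternionAlgebra

/-- The representation of a quaternion algebra attached to a factorisation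
`X ^ 2 - b X - a = (X - α) (X - β)`: `i` acts as `diag(α, β)` and `j` as `(0 c; 1 0)`. -/
def splitHom {K : Type*} [CommRing K] {a b : K} (c : K) {α β : K} (hb : α + β = b)
    (ha : α * β = -a) : ℍ[K,a,b,c] →+* Matrix (Fin 2) (Fin 2) K where
  toFun x := !![x.re + x.imI * α, c * (x.imJ + x.imK * α); x.imJ + x.imK * β, x.re + x.imI * β]
  map_one' := by simp [Matrix.one_fin_two]
  map_zero' := by ext i j; fin_cases i <;> fin_cases j <;> simp
  map_add' x y := by ext i j; fin_cases i <;> fin_cases j <;> simp <;> ring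
  map_mul' x y := by
    obtain rfl : a = -(α * β) := by rw [ha, neg_neg]
    subst hb
    ext i j; fin_cases i <;> fin_cases j <;> simp [Matrix.mul_apply, Fin.sum_univ_two] <;> ring

section Split

variable {K : Type*} [Field K] {a b c α β : K} (hb : α + β = b) (ha : α * β = -a)

theorem splitHom_apply (x : ℍ[K,a,b,c]) : splitHom c hb ha x =
    !![x.re + x.imI * α, c * (x.imJ + x.imK * α); x.imJ + x.imK * β, x.re + x.imI * β] := rfl

theorem splitHom_star (x : ℍ[K,a,b,c]) :
    splitHom c hb ha (star x) = (splitHom c hb ha x).adjugate := by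
  subst hb
  rw [splitHom_apply, splitHom_apply, Matrix.adjugate_fin_two_of]
  ext i j; fin_cases i <;> fin_cases j <;> simp <;> ring

theorem splitHom_injective (hc : c ≠ 0) (hαβ : α ≠ β) :
    Function.Injective (splitHom c hb ha) := by
  rw [injective_iff_map_eq_zero]
  intro x hx
  rw [splitHom_apply] at hx
  have h00 := congrFun (congrFun hx 0) 0
  have h01 := congrFun (congrFun hx 0) 1
  have h10 := congrFun (congrFun hx 1) 0
  have h11 := congrFun (congrFun hx 1) 1
  simp [hc] at h00 h01 h10 h11
  have hδ : α - β ≠ 0 := sub_ne_zero.2 hαβ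
  have hI : x.imI = 0 := (mul_eq_zero.1 (by linear_combination h00 - h11 :
    x.imI * (α - β) = 0)).resolve_right hδ
  have hK : x.imK = 0 := (mul_eq_zero.1 (by linear_combination h01 - h10 :
    x.imK * (α - β) = 0)).resolve_right hδ
  rw [hI, zero_mul, add_zero] at h00
  rw [hK, zero_mul, add_zero] at h01
  ext <;> simp [*]

/-- A quaternion algebra for which `X ^ 2 - b X - a` has distinct roots in `K` has matrix units. -/
theorem exists_adjugateUnits (hc : c ≠ 0) (hαβ : α ≠ β) :
    ∃ e₁₁ e₁₂ e₂₁ e₂₂ : ℍ[K,a,b,c], SLStar.AdjugateUnits e₁₁ e₁₂ e₂₁ e₂₂ ∧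
      splitHom c hb ha e₁₁ = Matrix.single 0 0 1 ∧ splitHom c hb ha e₁₂ = Matrix.single 0 1 1 ∧
      splitHom c hb ha e₂₁ = Matrix.single 1 0 1 ∧ splitHom c hb ha e₂₂ = Matrix.single 1 1 1 := by
  have hδ : α - β ≠ 0 := sub_ne_zero.2 hαβ
  let e₁₁ : ℍ[K,a,b,c] := ⟨-β / (α - β), 1 / (α - β), 0, 0⟩
  let e₁₂ : ℍ[K,a,b,c] := ⟨0, 0, -β / (c * (α - β)), 1 / (c * (α - β))⟩
  let e₂₁ : ℍ[K,a,b,c] := ⟨0, 0, α / (α - β), -1 / (α - β)⟩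
  let e₂₂ : ℍ[K,a,b,c] := ⟨α / (α - β), -1 / (α - β), 0, 0⟩
  have h11 : splitHom c hb ha e₁₁ = !![1, 0; 0, 0] := by
    rw [splitHom_apply]
    ext i j; fin_cases i <;> fin_cases j <;> simp [e₁₁] <;> field_simp <;> ring
  have h12 : splitHom c hb ha e₁₂ = !![0, 1; 0, 0] := by
    have h1 : c * (-β / (c * (α - β)) + 1 / (c * (α - β)) * α) = 1 := by field_simp; ring
    have h2 : -β / (c * (α - β)) + 1 / (c * (α - β)) * β = 0 := by field_simp; ring
    simp only [splitHom_apply, e₁₂, h1, h2, zero_mul, add_zero]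
  have h21 : splitHom c hb ha e₂₁ = !![0, 0; 1, 0] := by
    have h1 : α / (α - β) + -1 / (α - β) * α = 0 := by field_simp; ring
    have h2 : α / (α - β) + -1 / (α - β) * β = 1 := by field_simp; ring
    simp only [splitHom_apply, e₂₁, h1, h2, zero_mul, add_zero, mul_zero]
  have h22 : splitHom c hb ha e₂₂ = !![0, 0; 0, 1] := by
    rw [splitHom_apply]
    ext i j; fin_cases i <;> fin_cases j <;> simp [e₂₂] <;> field_simp <;> ring
  refine ⟨e₁₁, e₁₂, e₂₁, e₂₂, ?_, ?_, ?_, ?_, ?_⟩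
  · constructor <;> apply splitHom_injective hb ha hc hαβ <;>
      simp only [map_mul, map_zero, map_neg, splitHom_star, h11, h12, h21, h22,
        Matrix.adjugate_fin_two_of] <;>
      ext i j <;> fin_cases i <;> fin_cases j <;> simp
  · rw [h11]; ext i j; fin_cases i <;> fin_cases j <;> simp
  · rw [h12]; ext i j; fin_cases i <;> fin_cases j <;> simp
  · rw [h21]; ext i j; fin_cases i <;> fin_cases j <;> simp
  · rw [h22]; ext i j; fin_cases i <;> fin_cases j <;> simp

end Split

end QuaternionAlgebra

namespace AdeleRing

variable {F : Type*} [Field F] [IsGlobalField F]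

/-- The inclusion of the completion at `v` as a factor of the adele ring. -/
noncomputable def single (v : Place F) : v.Completion →ₙ+* AdeleRing F :=
  letI := Classical.decEq (Place F)
  { toFun := fun x => ⟨Pi.single v x, (Set.finite_singleton v).subset fun w hw => by
      by_contra hne
      have := hw.2
      rw [Pi.single_eq_of_ne hne, norm_zero] at this
      exact absurd this (by norm_num)⟩
    map_zero' := Subtype.ext (Pi.single_zero v)
    map_add' := fun x y => Subtype.ext (Pi.single_add v x y)
    map_mul' := fun x y => Subtype.ext (Pi.single_mul v x y) }

theorem eval_single (v : Place F) (x : v.Completion) : eval v (single v x) = x := by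
  classical
  exact Pi.single_eq_same v x

theorem algebraMap_mul_single (v : Place F) (r : F) (x : v.Completion) :
    algebraMap F (AdeleRing F) r * single v x = single v (algebraMap F v.Completion r * x) := by
  classical
  refine Subtype.ext (funext fun w => ?_)
  change algebraMap F w.Completion r * Pi.single v x w =
    Pi.single (M := fun w : Place F => w.Completion) v (algebraMap F v.Completion r * x) w
  rcases eq_or_ne w v with rfl | hw
  · rw [Pi.single_eq_same, Pi.single_eq_same]
  · rw [Pi.single_eq_of_ne hw, Pi.single_eq_of_ne hw, mul_zero]

/-- The inclusion of the local component at `v` into the quaternions with adelic coordinates. -/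
noncomputable def quaternionSingle (v : Place F) (a b c : F) :
    Over v.Completion a b c →ₙ+* Over (AdeleRing F) a b c where
  toFun x := ⟨single v x.re, single v x.imI, single v x.imJ, single v x.imK⟩
  map_zero' := by ext <;> simp
  map_add' x y := by ext <;> simp
  map_mul' x y := by
    ext1 <;> simp only [QuaternionAlgebra.mk_mul_mk, QuaternionAlgebra.re_mul,
      QuaternionAlgebra.imI_mul, QuaternionAlgebra.imJ_mul, QuaternionAlgebra.imK_mul, map_add,
      map_sub, mul_assoc, ← algebraMap_mul_single] <;> simp only [map_mul]

theorem quaternionSingle_apply (v : Place F) (a b c : F) (x : Over v.Completion a b c) :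
    quaternionSingle v a b c x = ⟨single v x.re, single v x.imI, single v x.imJ, single v x.imK⟩ :=
  rfl

theorem quaternionSingle_star (v : Place F) (a b c : F) (x : Over v.Completion a b c) :
    quaternionSingle v a b c (star x) = star (quaternionSingle v a b c x) := by
  rw [quaternionSingle_apply, quaternionSingle_apply]
  ext1 <;> simp [algebraMap_mul_single]

theorem quaternionEval_quaternionSingle (v : Place F) (a b c : F) (x : Over v.Completion a b c) :
    quaternionEval F a b c v (quaternionSingle v a b c x) = x :=
  QuaternionAlgebra.ext (eval_single v _) (eval_single v _) (eval_single v _) (eval_single v _)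

end AdeleRing

/-! ### Adelic quaternions -/

namespace AdelicQuaternions

variable (F H : Type*) [Field F] [IsGlobalField F] [Ring H] [Algebra F H]
  [hH : IsQuaternionAlgebra F H]

/-- Adelic quaternions are quaternions with adelic coordinates. -/
theorem exists_ringEquiv : ∃ a b c : F, b ^ 2 + 4 * a ≠ 0 ∧ c ≠ 0 ∧
    ∃ Ψ : AdelicQuaternions F H ≃+* Over (AdeleRing F) a b c, ∀ x, Ψ (star x) = star (Ψ x) := by
  obtain ⟨a, b, c, hD, hc, ⟨e⟩⟩ := hH.exists_algEquiv
  exact ⟨a, b, c, hD, hc, QuaternionConj.exists_ringEquiv_extend e (AdeleRing F)⟩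

theorem closure_bruhatElements_eq_top [CharP F 2] (n : ℕ) :
    Subgroup.closure (bruhatElements (Matrix (Fin n) (Fin n) (AdelicQuaternions F H))) = ⊤ := by
  obtain ⟨a, b, c, hD, hc, Ψ, hΨ⟩ := exists_ringEquiv F H
  have h2 : (2 : F) = 0 := CharTwo.two_eq_zero
  have hb : b ≠ 0 := by
    rintro rfl
    apply hD
    linear_combination 2 * a * h2
  let Φ : Matrix (Fin n) (Fin n) (AdelicQuaternions F H) ≃+*
    AdeleRing.QuaternionMatrix F a b c (Fin n) := Ψ.mapMatrix
  have hΦ : ∀ X, Φ (star X) = star (Φ X) := Matrix.mapMatrix_star Ψ.toRingHom hΨ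
  refine SLStar.closure_bruhatElements_eq_top fun A C X Y hAC hXY => ?_
  obtain ⟨s, hs, hu⟩ := AdeleRing.exists_isUnit_add_mul h2 hb hc (A := Φ A) (C := Φ C)
    (X := Φ X) (Y := Φ Y) (by rw [← hΦ, ← hΦ, ← map_mul, ← map_mul, hAC])
    (by rw [← map_mul, ← map_mul, ← map_add, hXY, map_one])
  refine ⟨Φ.symm s, Φ.injective ?_, ?_⟩
  · rw [hΦ, Φ.apply_symm_apply, hs]
  · rw [← MulEquiv.isUnit_map Φ, map_add, map_mul, Φ.apply_symm_apply]
    exact hu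

theorem closure_bruhatElements_ne_top (h2 : (2 : F) ≠ 0) {n : ℕ} (hn : 1 ≤ n) :
    Subgroup.closure (bruhatElements (Matrix (Fin n) (Fin n) (AdelicQuaternions F H))) ≠ ⊤ := by
  obtain ⟨a, b, c, hD, hc, Ψ, hΨ⟩ := exists_ringEquiv F H
  obtain ⟨v, d, hd⟩ := Place.exists_sq_eq h2 hD
  let ν : F →+* v.Completion := algebraMap F v.Completion
  have hν2 : (2 : v.Completion) ≠ 0 := by
    rw [← map_ofNat ν 2, map_ne_zero]; exact h2
  have hd0 : d ≠ 0 := by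
    rintro rfl
    rw [zero_pow two_ne_zero, eq_comm, map_eq_zero] at hd
    exact hD hd
  have hd' : d ^ 2 = ν b ^ 2 + 4 * ν a := by
    rw [hd, map_add, map_pow, map_mul, map_ofNat]
  -- the roots of `X ^ 2 - b X - a`
  have hsum : (ν b + d) / 2 + (ν b - d) / 2 = ν b := by field_simp; ring
  have hprod : (ν b + d) / 2 * ((ν b - d) / 2) = -ν a := by
    field_simp
    linear_combination -hd'
  have hne : (ν b + d) / 2 ≠ (ν b - d) / 2 := by
    intro h
    rw [div_left_inj' hν2] at h
    have : 2 * d = 0 := by linear_combination h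
    exact (mul_ne_zero hν2 hd0) this
  obtain ⟨e₁₁, e₁₂, e₂₁, e₂₂, he, h11, h12, h21, h22⟩ :=
    QuaternionAlgebra.exists_adjugateUnits (c := ν c) hsum hprod ((map_ne_zero ν).2 hc) hne
  let σ : Over v.Completion a b c →ₙ+* AdelicQuaternions F H :=
    (Ψ.symm : Over (AdeleRing F) a b c →ₙ+* AdelicQuaternions F H).comp
      (AdeleRing.quaternionSingle v a b c)
  let χ : AdelicQuaternions F H →+* Matrix (Fin 2) (Fin 2) v.Completion :=
    ((QuaternionAlgebra.splitHom (ν c) hsum hprod).comp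
      (AdeleRing.quaternionEval F a b c v)).comp (Ψ : AdelicQuaternions F H →+* _)
  have hσ : ∀ x, σ (star x) = star (σ x) := fun x => Ψ.injective (by
    change Ψ (Ψ.symm _) = Ψ (star (Ψ.symm _))
    rw [hΨ, Ψ.apply_symm_apply, Ψ.apply_symm_apply]
    exact AdeleRing.quaternionSingle_star v a b c x)
  have hχσ : ∀ x, χ (σ x) = QuaternionAlgebra.splitHom (ν c) hsum hprod x := fun x => by
    change QuaternionAlgebra.splitHom (ν c) hsum hprod
      (AdeleRing.quaternionEval F a b c v (Ψ (Ψ.symm _))) = _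
    rw [Ψ.apply_symm_apply]
    exact congrArg _ (AdeleRing.quaternionEval_quaternionSingle v a b c x)
  have hχ : ∀ x, χ (star x) = (χ x).adjugate := fun x => by
    change QuaternionAlgebra.splitHom (ν c) hsum hprod
      (AdeleRing.quaternionEval F a b c v (Ψ (star x))) = _
    rw [hΨ]
    exact (congrArg _ (QuaternionAlgebra.mapHom_star _ _ _ _ _)).trans
      (QuaternionAlgebra.splitHom_star hsum hprod _)
  have : Nonempty (Fin n) := ⟨⟨0, hn⟩⟩
  exact SLStar.closure_bruhatElements_ne_top
    (fun h => hν2 (by linear_combination -h)) χ hχ (he.map σ hσ)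
    ((hχσ _).trans h11) ((hχσ _).trans h12) ((hχσ _).trans h21) ((hχσ _).trans h22)

end AdelicQuaternions

theorem mainTheorem2 (F : Type*) [Field F] [IsGlobalField F] (H : Type*) [Ring H] [Algebra F H]
    [IsQuaternionAlgebra F H] (n : ℕ) (hn : 1 ≤ n) :
    Subgroup.closure (bruhatElements (Matrix (Fin n) (Fin n) (AdelicQuaternions F H))) = ⊤ ↔
      CharP F 2 := by
  refine ⟨fun h => ?_, fun _ => AdelicQuaternions.closure_bruhatElements_eq_top F H n⟩
  by_contra hF
  refine AdelicQuaternions.closure_bruhatElements_ne_top F H (fun h2 => hF ?_) hn h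
  exact CharTwo.of_one_ne_zero_of_two_eq_zero one_ne_zero h2
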